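/- Let $a>0$, let $\nu\in\mathbb C$ with $\operatorname{Re}\nu>0$, $\nu\notin\{1,2,\dots\}$, put $\nu_0=\nu^2-\tfrac14$, and let $q:(0,\infty)\to\mathbb C$ satisfy, for some $T>a$, $q(x)|x-a|^{\min(0,1-2\operatorname{Re}\nu)}\in L(0,T)$ and $q\in L(T,\infty)$. Let $A=[a_{jk}]_{j,k=1,2}$ be a complex matrix with $\det A\neq0$, $a_{12}=0$ and $|\xi_{11}|,|\xi_{22}|>|\xi_{12}|>0$, where $$\xi_{11}=\frac{-a_{11}e^{2\pi i\nu}+a_{22}e^{-2\pi i\nu}}{2\sin\pi\nu},\quad \xi_{12}=\frac{-i(a_{11}e^{\pi i\nu}-a_{22}e^{-\pi i\nu})}{2\sin\pi\nu},\quad \xi_{22}=\frac{a_{11}-a_{22}}{2\sin\pi\nu}.$$ Consider the equation $-y''+\big(\frac{\nu_0}{(x-a)^2}+q(x)\big)y=\lambda y$, $x>0$. For $j=1,2$ let $\mu_j=(-1)^j\nu+\frac12$, fix $c_{10},c_{20}$ with $c_{10}c_{20}=(2\nu)^{-1}$, and put $$C_j(x,\lambda)=(x-a)^{\mu_j}\sum_{k\ge0}c_{jk}\lambda^k(x-a)^{2k},\qquad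 c_{jk}=(-1)^kc_{j0}\prod_{s=1}^k\big((2s+\mu_j)(2s+\mu_j-1)-\nu_0\big)^{-1},$$ with principal powers ($\arg\in(-\pi,\pi]$). Let $s_j(x,\lambda)$ be the solutions, for $0\le x<a$ and for $x>a$, of $$s_j(x,\lambda)=C_j(x,\lambda)+\int_a^x\big(C_1(t,\lambda)C_2(x,\lambda)-C_1(x,\lambda)C_2(t,\lambda)\big)q(t)s_j(t,\lambda)\,dt,$$ and let $\sigma_j=s_j$ for $x<a$, $\sigma_j=\sum_{k=1}^2a_{kj}s_k$ for $x>a$. For $\operatorname{Im}\rho\ge0$, $\rho\ne0$, let $e(x,\rho)=\sum_{k=1}^2A_k(\rho)\sigma_k(x,\rho^2)$ be the solution of this form with $\lim_{x\to\infty}e(x,\rho)e^{-i\rho x}=1$, and let $\Delta(\rho)=e(0,\rho)$. The Weyl function is $M(\lambda)=\Phi'(0,\lambda)$, where $\Phi(x,\lambda)=e(x,\rho)/\Delta(\rho)$, $\lambda=\rho^2$, and $'=d/dx$. Let $\Lambda_+=[0,\infty)$ and $\Pi_+=\mathbb C\setminus\Lambda_+$, and let $\Pi$ be $\Pi_+$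 together with both banks of the cut along $\Lambda_+$, without the origin, so that $\rho\mapsto\rho^2$ identifies $\{\operatorname{Im}\rho>0\}$ with $\Pi_+$ and $\{\operatorname{Im}\rho\ge0,\ \rho\ne0\}$ with $\Pi$. Put $\Lambda=\{\rho^2:\operatorname{Im}\rho\ge0,\ \rho\ne0,\ \Delta(\rho)=0\}$ (regarded also as a subset of $\Pi$) and $\Lambda'=\{\rho^2:\operatorname{Im}\rho>0,\ \Delta(\rho)=0\}$. **Theorem 1.** The Weyl function $M(\lambda)$ is analytic in $\Pi_+\setminus\Lambda'$ and continuous in $\Pi\setminus\Lambda$. Its set of singularities as an analytic function, that is, the set of those $\lambda_0\in\mathbb C$ for which no function analytic in a neighbourhood of $\lambda_0$ coincides with $M$ on the part of $\Pi_+\setminus\Lambda'$ in that neighbourhood, is exactly $\Lambda_+\cup\Lambda$. -/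

import Mathlib

open MeasureTheory Set Filter Topology

noncomputable section

/-! Indices `1, 2` of the mathematics are the elements `0, 1` of `Fin 2`. -/

/-- The data of the boundary value problem: the singular point `a`, the parameter `ν`, the
normalising constants `c₁₀, c₂₀`, the transition matrix `A` and the potential `q`
(only its values on `(0, ∞)` matter). -/
structure SLProblem where
  a : ℝ
  ν : ℂ
  c₀ : Fin 2 → ℂ
  A : Matrix (Fin 2) (Fin 2) ℂ
  q : ℝ → ℂ

/-- The ray `Λ₊ = [0, ∞)` in the complex plane. -/
def rayPlus : Set ℂ := {z | 0 ≤ z.re ∧ z.im = 0}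

/-- The plane cut along `[0, ∞)` (interior points only). -/
def PiPlus : Set ℂ := rayPlusᶜ

/-- The plane with the two-sided cut along `[0, ∞)`, both banks included and the origin removed.
A point is recorded by its square root `ρ` in the closed upper half-plane, which is a global
homeomorphic coordinate: `Im ρ > 0` are the points off the cut, `ρ > 0` is the upper
bank and `ρ < 0` the lower bank. -/
abbrev CutPlane : Type := {ρ : ℂ // 0 ≤ ρ.im ∧ ρ ≠ 0}

/-- The underlying point `λ = ρ²` of the complex plane. -/
def CutPlane.toPlane (p : CutPlane) : ℂ := (p : ℂ) ^ 2

/-- The square root of `z` in the upper half-plane (for `z` off `[0, ∞)`). -/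
def upperRoot (z : ℂ) : ℂ := Complex.I * (-z) ^ (1 / 2 : ℂ)

theorem upperRoot_sq (z : ℂ) : upperRoot z ^ 2 = z := by
  have h : ((-z) ^ (1 / 2 : ℂ)) ^ 2 = -z := by
    rw [← Complex.cpow_nat_mul]; norm_num
  rw [upperRoot, mul_pow, h, Complex.I_sq]; ring

theorem upperRoot_im_pos {z : ℂ} (hz : z ∈ PiPlus) : 0 < (upperRoot z).im := by
  have hz0 : -z ≠ 0 := by
    intro h
    apply hz
    have : z = 0 := neg_eq_zero.mp h
    simp [rayPlus, this]
  have harg : (-z).arg ≠ Real.pi := by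
    intro h
    rw [Complex.arg_eq_pi_iff] at h
    apply hz
    simp only [Complex.neg_re, Complex.neg_im] at h
    exact ⟨by linarith [h.1], by linarith [h.2]⟩
  have h1 : (Complex.log (-z) * (1 / 2)).im = (-z).arg / 2 := by
    have : Complex.log (-z) * (1 / 2) = Complex.log (-z) / (2 : ℝ) := by push_cast; ring
    rw [this, Complex.div_ofReal_im, Complex.log_im]
  have hlt : (-z).arg < Real.pi := lt_of_le_of_ne (Complex.arg_le_pi _) harg
  have hgt := Complex.neg_pi_lt_arg (-z)
  rw [upperRoot, Complex.I_mul_im, Complex.cpow_def_of_ne_zero hz0, Complex.exp_re, h1]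
  exact mul_pos (Real.exp_pos _) (Real.cos_pos_of_mem_Ioo ⟨by linarith, by linarith⟩)

/-- The set of singularities of an analytic function `f` given on `D ⊆ ℂ`: the points near which
no function analytic at the point agrees with `f` on `D`. -/
def singularSet (f : ℂ → ℂ) (D : Set ℂ) : Set ℂ :=
  {z | ¬ ∃ F : ℂ → ℂ, AnalyticAt ℂ F z ∧ ∀ᶠ w in 𝓝[D] z, F w = f w}

namespace SLProblem

variable (P : SLProblem)

/-- `ν₀ = ν² - 1/4`. -/
def ν₀ : ℂ := P.ν ^ 2 - 1 / 4

/-- The class `W` of potentials: `q |x - a|^min(0, 1 - 2 Re ν) ∈ L(0, T)` and `q ∈ L(T, ∞)`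
for some `T > a`. -/
def PotentialInW : Prop :=
  ∃ T : ℝ, P.a < T ∧
    IntegrableOn (fun x : ℝ => P.q x * ((|x - P.a| ^ min 0 (1 - 2 * P.ν.re) : ℝ) : ℂ))
      (Ioo 0 T) ∧
    IntegrableOn P.q (Ioi T)

/-- `μ₁ = 1/2 - ν`, `μ₂ = 1/2 + ν`. -/
def μ (j : Fin 2) : ℂ := (-1) ^ (j.val + 1) * P.ν + 1 / 2

/-- The coefficients `c_{jk}`. -/
def coeff (j : Fin 2) (k : ℕ) : ℂ :=
  (-1) ^ k * P.c₀ j *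
    (∏ s ∈ Finset.Icc 1 k, ((2 * (s : ℂ) + P.μ j) * (2 * (s : ℂ) + P.μ j - 1) - P.ν₀))⁻¹

/-- The solutions `C_j(x, λ)` of the equation with `q = 0`; the power is the principal one. -/
def C (j : Fin 2) (x : ℝ) (lam : ℂ) : ℂ :=
  ((x - P.a : ℝ) : ℂ) ^ P.μ j *
    ∑' k : ℕ, P.coeff j k * (lam ^ k * ((x - P.a : ℝ) : ℂ) ^ (2 * k))

/-- The kernel `g(x, t, λ)`. -/
def g (x t : ℝ) (lam : ℂ) : ℂ :=
  P.C 0 t lam * P.C 1 x lam - P.C 0 x lam * P.C 1 t lam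

/-- The half-line `[0, ∞)` without the singular point. -/
def dom : Set ℝ := {x | 0 ≤ x ∧ x ≠ P.a}

/-- `s` is a solution of the integral equation
`s(x) = C_j(x, λ) + ∫_a^x g(x, t, λ) q(t) s(t) dt` for `x > a` and for `0 ≤ x < a`,
the integral being absolutely convergent. -/
def IsIntegralSolution (j : Fin 2) (lam : ℂ) (s : ℝ → ℂ) : Prop :=
  ContinuousOn s P.dom ∧
  ∀ x ∈ P.dom,
    (∀ i : Fin 2,
      IntervalIntegrable (fun t => P.C i t lam * P.q t * s t) volume P.a x) ∧
    s x = P.C j x lam + ∫ t in P.a..x, P.g x t lam * P.q t * s t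

open Classical in
/-- The (unique) solution `s_j(x, λ)` of the integral equation. -/
def s (j : Fin 2) (x : ℝ) (lam : ℂ) : ℂ :=
  if h : ∃ f : ℝ → ℂ, P.IsIntegralSolution j lam f then Classical.choose h x else 0

/-- The fundamental system `σ_j(x, λ)` matched across `x = a` by the transition matrix. -/
def σ (j : Fin 2) (x : ℝ) (lam : ℂ) : ℂ :=
  if x < P.a then P.s j x lam else ∑ k : Fin 2, P.A k j * P.s k x lam

/-- `B₁, B₂` are the coefficients of the Jost solution:
`(B₁ σ₁(x, ρ²) + B₂ σ₂(x, ρ²)) exp(-iρx) → 1` as `x → ∞`. -/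
def IsJostCoeff (ρ : ℂ) (B : Fin 2 → ℂ) : Prop :=
  Tendsto (fun x : ℝ => (∑ k : Fin 2, B k * P.σ k x (ρ ^ 2)) * Complex.exp (-Complex.I * ρ * x))
    atTop (𝓝 1)

open Classical in
/-- The (unique) coefficients `A_k(ρ)` of the Jost solution. -/
def jostCoeff (ρ : ℂ) : Fin 2 → ℂ :=
  if h : ∃ B : Fin 2 → ℂ, P.IsJostCoeff ρ B then Classical.choose h else 0

/-- The discontinuous Jost solution `e(x, ρ)`. -/
def jost (x : ℝ) (ρ : ℂ) : ℂ := ∑ k : Fin 2, P.jostCoeff ρ k * P.σ k x (ρ ^ 2)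

/-- The characteristic function `Δ(ρ) = e(0, ρ)`. -/
def Δ (ρ : ℂ) : ℂ := P.jost 0 ρ

/-- The Weyl solution `Φ = e / Δ`. -/
def weylSolution (x : ℝ) (ρ : ℂ) : ℂ := P.jost x ρ / P.Δ ρ

/-- The Weyl function `M = Φ'(0)` in terms of `ρ`; the derivative at the endpoint `0` of the
half-line is the one-sided one. -/
def weylRho (ρ : ℂ) : ℂ := derivWithin (fun x : ℝ => P.weylSolution x ρ) (Ici 0) 0

/-- The Weyl function on the plane with two-sided cut. -/
def weylCut (p : CutPlane) : ℂ := P.weylRho p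

/-- The Weyl function as a function of `λ ∈ Π₊`. -/
def weyl (lam : ℂ) : ℂ := P.weylRho (upperRoot lam)

/-- `Λ` as a subset of the plane with two-sided cut. -/
def LamCut : Set CutPlane := {p | P.Δ p = 0}

/-- `Λ` as a set of complex numbers. -/
def Lam : Set ℂ := {z | ∃ ρ : ℂ, 0 ≤ ρ.im ∧ ρ ≠ 0 ∧ P.Δ ρ = 0 ∧ z = ρ ^ 2}

/-- `Λ'`, the part of `Λ` coming from the open upper half-plane. -/
def Lam' : Set ℂ := {z | ∃ ρ : ℂ, 0 < ρ.im ∧ P.Δ ρ = 0 ∧ z = ρ ^ 2}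

/-- The matrix `ξ_{jk}`. -/
def ξ : Matrix (Fin 2) (Fin 2) ℂ :=
  (1 / (2 * Complex.sin (Real.pi * P.ν))) •
    !![-P.A 0 0 * Complex.exp (2 * Real.pi * Complex.I * P.ν)
          + P.A 1 1 * Complex.exp (-2 * Real.pi * Complex.I * P.ν),
        -Complex.I * (P.A 0 0 * Complex.exp (Real.pi * Complex.I * P.ν)
          - P.A 1 1 * Complex.exp (-Real.pi * Complex.I * P.ν));
        -Complex.I * (P.A 0 0 * Complex.exp (Real.pi * Complex.I * P.ν)
          - P.A 1 1 * Complex.exp (-Real.pi * Complex.I * P.ν)),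
        P.A 0 0 - P.A 1 1]

end SLProblem

end

/-! Writing e'(0,ρ) as `dΔ`, one has M = `dΔ`/`Δ`. Numerator and denominator are holomorphic for Im
ρ > 0 and continuous up to the real axis without the origin: s_j and s_j' are entire in λ, and the
coefficients A_k(ρ) are, by Cramer's rule, Wronskians of the σ_j with a Jost solution built from
infinity. The analyticity and continuity of M follow, because λ ↦ ρ is holomorphic on Π₊.

The singularities rest on one relation (`mul_Δ_eq_dΔ`): if F continues M analytically to a
neighbourhood of ρ², then F(ρ²)Δ(ρ) = dΔ(ρ), since the points with Δ ≠ 0 are dense. At a zero of Δ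
this forces dΔ(ρ) = 0, which would make the Jost solution trivial (`dΔ_ne_zero`). At λ > 0 the
relation holds at both roots ±ρ with the same value F(λ), so the Wronskian Δ(ρ)dΔ(-ρ) - dΔ(ρ)Δ(-ρ)
vanishes; but e(·,ρ) and e(·,-ρ) are independent by their behaviour at infinity
(`wronskian_banks_ne_zero`). The origin is singular because the singular set is closed.

Two constructions carry the analysis, both through `exists_volterra_solution`. Near x = a, variation
of constants s_j = α₁C₁ + α₂C₂ gives a linear system for α whose matrix is integrable through a;
this is what the weight in the class W provides (`exists_amplitude`). Near infinity, e^{-iρx}e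
solves a Volterra equation on (x,∞) with kernel O(|V|/|ρ|) (`exists_jost`). Uniqueness of the A_k
(`eq_zero_of_tendsto_zero`) identifies the chosen coefficients with the holomorphic ones. -/

noncomputable section

/-! ### Calculus of indefinite integrals of merely integrable functions. -/

/-- `F` is an indefinite integral of the locally integrable function `f` on `I`. -/
def IsPrimitiveOn {𝕜 : Type*} [RCLike 𝕜] (I : Set ℝ) (F f : ℝ → 𝕜) : Prop :=
  ∀ ⦃x⦄, x ∈ I → ∀ ⦃y⦄, y ∈ I → IntervalIntegrable f volume x y ∧ F y - F x = ∫ t in x..y, f t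

namespace IsPrimitiveOn

variable {𝕜 : Type*} [RCLike 𝕜] {I : Set ℝ} {F G f g : ℝ → 𝕜}

theorem mono {J : Set ℝ} (hF : IsPrimitiveOn I F f) (h : J ⊆ I) : IsPrimitiveOn J F f :=
  fun _ hx _ hy => hF (h hx) (h hy)

theorem congr [hI : I.OrdConnected] (hF : IsPrimitiveOn I F f) (hG : ∀ x ∈ I, G x = F x)
    (hg : ∀ x ∈ I, g x = f x) : IsPrimitiveOn I G g := by
  intro x hx y hy
  have h : EqOn f g (uIcc x y) := fun t ht => (hg t (hI.uIcc_subset hx hy ht)).symm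
  refine ⟨(hF hx hy).1.congr fun t ht => h (uIoc_subset_uIcc ht), ?_⟩
  rw [hG x hx, hG y hy, (hF hx hy).2]
  exact intervalIntegral.integral_congr h

theorem const (c : 𝕜) : IsPrimitiveOn I (fun _ => c) (fun _ => 0) := by
  intro x _ y _
  simp

theorem add (hF : IsPrimitiveOn I F f) (hG : IsPrimitiveOn I G g) :
    IsPrimitiveOn I (fun x => F x + G x) (fun x => f x + g x) := by
  intro x hx y hy
  refine ⟨(hF hx hy).1.add (hG hx hy).1, ?_⟩
  rw [intervalIntegral.integral_add (hF hx hy).1 (hG hx hy).1, ← (hF hx hy).2, ← (hG hx hy).2]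
  ring

theorem const_mul (c : 𝕜) (hF : IsPrimitiveOn I F f) :
    IsPrimitiveOn I (fun x => c * F x) (fun x => c * f x) := by
  intro x hx y hy
  refine ⟨(hF hx hy).1.const_mul c, ?_⟩
  rw [intervalIntegral.integral_const_mul, ← (hF hx hy).2]
  ring

theorem sub (hF : IsPrimitiveOn I F f) (hG : IsPrimitiveOn I G g) :
    IsPrimitiveOn I (fun x => F x - G x) (fun x => f x - g x) := by
  intro x hx y hy
  refine ⟨(hF hx hy).1.sub (hG hx hy).1, ?_⟩
  rw [intervalIntegral.integral_sub (hF hx hy).1 (hG hx hy).1, ← (hF hx hy).2, ← (hG hx hy).2]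
  ring

/-- Increments of `F` are dominated by those of the primitive of `‖f‖`, so absolute continuity is
inherited from it. -/
theorem absolutelyContinuous [hI : I.OrdConnected] (hF : IsPrimitiveOn I F f) {x y : ℝ}
    (hx : x ∈ I) (hy : y ∈ I) : AbsolutelyContinuousOnInterval F x y := by
  have h := (hF hx hy).1.norm.absolutelyContinuousOnInterval_intervalIntegral
    (c := x) left_mem_uIcc
  rw [absolutelyContinuousOnInterval_iff] at h ⊢
  intro ε hε
  obtain ⟨δ, hδ, h⟩ := h ε hε
  refine ⟨δ, hδ, fun E hE hE' => lt_of_le_of_lt (Finset.sum_le_sum fun i hi => ?_) (h E hE hE')⟩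
  have hm := hE.1 i hi
  have h1 := hI.uIcc_subset hx hy hm.1
  have h2 := hI.uIcc_subset hx hy hm.2
  rw [dist_comm, dist_eq_norm, (hF h1 h2).2, dist_comm, Real.dist_eq,
    intervalIntegral.integral_interval_sub_left (hF hx h2).1.norm (hF hx h1).1.norm]
  exact intervalIntegral.norm_integral_le_abs_integral_norm

/-- The two sides of `x` are treated separately because `x` may be an endpoint of `I`: a side
containing a further point of `I` lies in an interval of absolute continuity, and otherwise it
reduces to `x` itself. -/
theorem continuousOn [hI : I.OrdConnected] (hF : IsPrimitiveOn I F f) : ContinuousOn F I := by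
  intro x hx
  have hr : ContinuousWithinAt F (I ∩ Ici x) x := by
    by_cases h : ∃ y ∈ I, x < y
    · obtain ⟨y, hy, hxy⟩ := h
      have := (hF.absolutelyContinuous hx hy).continuousOn x left_mem_uIcc
      rw [uIcc_of_le hxy.le] at this
      refine this.mono_of_mem_nhdsWithin ?_
      exact mem_of_superset (inter_mem_nhdsWithin _ (Iic_mem_nhds hxy))
        fun t ht => ⟨ht.1.2, ht.2⟩
    · push Not at h
      refine (continuousWithinAt_singleton (f := F) (x := x)).mono ?_
      intro t ht
      exact le_antisymm (h t ht.1) ht.2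
  have hl : ContinuousWithinAt F (I ∩ Iic x) x := by
    by_cases h : ∃ y ∈ I, y < x
    · obtain ⟨y, hy, hxy⟩ := h
      have := (hF.absolutelyContinuous hx hy).continuousOn x left_mem_uIcc
      rw [uIcc_of_ge hxy.le] at this
      refine this.mono_of_mem_nhdsWithin ?_
      exact mem_of_superset (inter_mem_nhdsWithin _ (Ici_mem_nhds hxy))
        fun t ht => ⟨ht.2, ht.1.2⟩
    · push Not at h
      refine (continuousWithinAt_singleton (f := F) (x := x)).mono ?_
      intro t ht
      exact le_antisymm ht.2 (h t ht.1)
  have := hr.union hl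
  rwa [← inter_union_distrib_left, Ici_union_Iic, inter_univ] at this

theorem of_integral {c : ℝ}
    (h : ∀ x ∈ I, IntervalIntegrable f volume c x ∧ F x = F c + ∫ t in c..x, f t) :
    IsPrimitiveOn I F f := by
  intro x hx y hy
  refine ⟨(h x hx).1.symm.trans (h y hy).1, ?_⟩
  rw [(h x hx).2, (h y hy).2, ← intervalIntegral.integral_interval_sub_left (h y hy).1 (h x hx).1]
  ring

theorem of_intervalIntegrable {x y : ℝ} (h : IntervalIntegrable f volume x y) :
    IsPrimitiveOn (uIcc x y) (fun t => ∫ s in x..t, f s) f :=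
  of_integral (c := x) fun t ht =>
    ⟨h.mono_set (uIcc_subset_uIcc left_mem_uIcc ht), by simp⟩

/-- The product minus the integral of its formal derivative is absolutely continuous with derivative
zero almost everywhere, hence constant. All Wronskian identities below come from this product rule.
-/
theorem mul [hI : I.OrdConnected] (hF : IsPrimitiveOn I F f) (hG : IsPrimitiveOn I G g) :
    IsPrimitiveOn I (fun x => F x * G x) (fun x => f x * G x + F x * g x) := by
  intro x hx y hy
  have hsub := hI.uIcc_subset hx hy
  have h1 : IntervalIntegrable (fun t => f t * G t + F t * g t) volume x y :=
    ((hF hx hy).1.mul_continuousOn (hG.continuousOn.mono hsub)).add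
      ((hG hx hy).1.continuousOn_mul (hF.continuousOn.mono hsub))
  refine ⟨h1, ?_⟩
  have hac : AbsolutelyContinuousOnInterval
      (fun t => F t * G t - ∫ s in x..t, f s * G s + F s * g s) x y :=
    ((hF.absolutelyContinuous hx hy).smul (hG.absolutelyContinuous hx hy)).sub
      ((of_intervalIntegrable h1).absolutelyContinuous left_mem_uIcc right_mem_uIcc)
  have hd : ∀ᵐ t, t ∈ uIcc x y →
      HasDerivAt (fun t => F t * G t - ∫ s in x..t, f s * G s + F s * g s) 0 t := by
    -- The endpoints are discarded so that the interval is a neighbourhood of `t`.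
    have hne : ∀ z : ℝ, ∀ᵐ t : ℝ, t ≠ z := fun z => by simp [ae_iff, measure_singleton]
    filter_upwards [(hF hx hy).1.ae_hasDerivAt_integral, (hG hx hy).1.ae_hasDerivAt_integral,
      h1.ae_hasDerivAt_integral, hne x, hne y] with t hFt hGt hPt hx' hy' ht
    have hnhds : uIcc x y ∈ 𝓝 t := by
      rcases le_total x y with h | h
      · rw [uIcc_of_le h] at ht ⊢
        exact Icc_mem_nhds (lt_of_le_of_ne ht.1 (Ne.symm hx')) (lt_of_le_of_ne ht.2 hy')
      · rw [uIcc_of_ge h] at ht ⊢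
        exact Icc_mem_nhds (lt_of_le_of_ne ht.1 (Ne.symm hy')) (lt_of_le_of_ne ht.2 hx')
    have dF : HasDerivAt F (f t) t := by
      refine ((hFt ht x left_mem_uIcc).const_add (F x)).congr_of_eventuallyEq ?_
      filter_upwards [hnhds] with u hu
      rw [← (hF hx (hsub hu)).2]; ring
    have dG : HasDerivAt G (g t) t := by
      refine ((hGt ht x left_mem_uIcc).const_add (G x)).congr_of_eventuallyEq ?_
      filter_upwards [hnhds] with u hu
      rw [← (hG hx (hsub hu)).2]; ring
    have := (dF.fun_mul dG).fun_sub (hPt ht x left_mem_uIcc)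
    simpa using this
  obtain ⟨C, hC⟩ := hac.const_of_ae_hasDerivAt_zero hd
  have e1 := hC x left_mem_uIcc
  have e2 := hC y right_mem_uIcc
  simp only [intervalIntegral.integral_same, sub_zero] at e1
  rw [← e1] at e2
  linear_combination e2

theorem of_hasDerivAt [hI : I.OrdConnected] (h : ∀ x ∈ I, HasDerivAt F (f x) x)
    (hf : ContinuousOn f I) : IsPrimitiveOn I F f := by
  intro x hx y hy
  have hsub := hI.uIcc_subset hx hy
  have hi : IntervalIntegrable f volume x y := (hf.mono hsub).intervalIntegrable
  exact ⟨hi, (intervalIntegral.integral_eq_sub_of_hasDerivAt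
    (fun t ht => h t (hsub ht)) hi).symm⟩

theorem hasDerivWithinAt [hI : I.OrdConnected] (hF : IsPrimitiveOn I F f) {x : ℝ} (hx : x ∈ I)
    (hf : ContinuousWithinAt f I x) : HasDerivWithinAt F (f x) I x := by
  rw [hasDerivWithinAt_iff_isLittleO, Asymptotics.isLittleO_iff]
  intro ε hε
  obtain ⟨δ, hδ, h⟩ := Metric.continuousWithinAt_iff.1 hf ε hε
  filter_upwards [self_mem_nhdsWithin, mem_nhdsWithin_of_mem_nhds (Metric.ball_mem_nhds x hδ)]
    with y hy hyδ
  have e : F y - F x - (y - x) • f x = ∫ t in x..y, (f t - f x) := by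
    rw [intervalIntegral.integral_sub (hF hx hy).1 intervalIntegrable_const, ← (hF hx hy).2,
      intervalIntegral.integral_const]
  rw [e, Real.norm_eq_abs]
  refine intervalIntegral.norm_integral_le_of_norm_le_const fun t ht => ?_
  have htI := hI.uIcc_subset hx hy (uIoc_subset_uIcc ht)
  rw [← dist_eq_norm]
  refine (h htI ?_).le
  have h1 : |t - x| ≤ |y - x| := abs_sub_left_of_mem_uIcc (uIoc_subset_uIcc ht)
  rw [Real.dist_eq]
  exact lt_of_le_of_lt h1 hyδ

theorem eq_of_forall_zero (hF : IsPrimitiveOn I F f) [hI : I.OrdConnected] (hf : ∀ x ∈ I, f x = 0)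
    {x y : ℝ} (hx : x ∈ I) (hy : y ∈ I) : F x = F y := by
  have h := (hF hx hy).2
  rw [intervalIntegral.integral_congr (g := fun _ => (0 : 𝕜))
    fun t ht => hf t (hI.uIcc_subset hx hy ht), intervalIntegral.integral_zero] at h
  exact (sub_eq_zero.1 h).symm

theorem pow [hI : I.OrdConnected] (hF : IsPrimitiveOn I F f) (n : ℕ) :
    IsPrimitiveOn I (fun x => F x ^ (n + 1)) (fun x => (n + 1) * (f x * F x ^ n)) := by
  induction n with
  | zero => simpa using hF
  | succ n ih =>
    refine (ih.mul hF).congr (fun x _ => by ring) fun x _ => ?_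
    push_cast; ring

end IsPrimitiveOn

/-! ### Holomorphy inside a set with continuity up to its boundary. -/

/-- `f` is continuous on `S` and holomorphic in the interior of `S`. -/
def HolCont (S : Set ℂ) (f : ℂ → ℂ) : Prop :=
  ContinuousOn f S ∧ DifferentiableOn ℂ f (interior S)

namespace HolCont

variable {S : Set ℂ} {f g : ℂ → ℂ}

theorem const (c : ℂ) : HolCont S (fun _ => c) :=
  ⟨continuousOn_const, differentiableOn_const c⟩

theorem of_differentiable (hf : Differentiable ℂ f) : HolCont S f :=
  ⟨hf.continuous.continuousOn, hf.differentiableOn⟩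

theorem add (hf : HolCont S f) (hg : HolCont S g) : HolCont S (fun p => f p + g p) :=
  ⟨hf.1.add hg.1, hf.2.add hg.2⟩

theorem sub (hf : HolCont S f) (hg : HolCont S g) : HolCont S (fun p => f p - g p) :=
  ⟨hf.1.sub hg.1, hf.2.sub hg.2⟩

theorem mul (hf : HolCont S f) (hg : HolCont S g) : HolCont S (fun p => f p * g p) :=
  ⟨hf.1.mul hg.1, hf.2.mul hg.2⟩

theorem neg (hf : HolCont S f) : HolCont S (fun p => -f p) :=
  ⟨hf.1.neg, hf.2.neg⟩

theorem div (hf : HolCont S f) (hg : HolCont S g) (h : ∀ p ∈ S, g p ≠ 0) :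
    HolCont S (fun p => f p / g p) :=
  ⟨hf.1.div hg.1 h, hf.2.div hg.2 fun p hp => h p (interior_subset hp)⟩

theorem sum {ι : Type*} {s : Finset ι} {f : ι → ℂ → ℂ} (hf : ∀ i ∈ s, HolCont S (f i)) :
    HolCont S (fun p => ∑ i ∈ s, f i p) :=
  ⟨continuousOn_finsetSum _ fun i hi => (hf i hi).1,
    DifferentiableOn.fun_sum fun i hi => (hf i hi).2⟩

theorem congr (hf : HolCont S f) (h : ∀ p ∈ S, g p = f p) : HolCont S g :=
  ⟨hf.1.congr h, hf.2.congr fun p hp => h p (interior_subset hp)⟩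

theorem tsum {u : ℕ → ℝ} (hu : Summable u) {F : ℕ → ℂ → ℂ} (hF : ∀ n, HolCont S (F n))
    (hb : ∀ n, ∀ p ∈ S, ‖F n p‖ ≤ u n) : HolCont S (fun p => ∑' n, F n p) :=
  ⟨continuousOn_tsum (fun n => (hF n).1) hu hb,
    Complex.differentiableOn_tsum_of_summable_norm hu (fun n => (hF n).2) isOpen_interior
      fun n p hp => hb n p (interior_subset hp)⟩

/-- Continuity is dominated convergence. For holomorphy one differentiates under the integral;
Cauchy's estimate on discs of radius ε/4 dominates the derivative by a multiple of `b`. -/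
theorem integral {α : Type*} [MeasurableSpace α] {μ : Measure α} {F : ℂ → α → ℂ} {b : α → ℝ}
    (hm : ∀ p ∈ S, AEStronglyMeasurable (F p) μ) (hb : ∀ᵐ t ∂μ, ∀ p ∈ S, ‖F p t‖ ≤ b t)
    (hF : ∀ᵐ t ∂μ, HolCont S (fun p => F p t)) (hi : Integrable b μ) :
    HolCont S (fun p => ∫ t, F p t ∂μ) := by
  constructor
  · refine continuousOn_of_dominated hm (fun p hp => hb.mono fun t ht => ht p hp) hi
      (hF.mono fun t ht => ht.1)
  · intro p hp
    obtain ⟨ε, hε, hball⟩ := Metric.isOpen_iff.1 (isOpen_interior (s := S)) p hp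
    have hε2 : 0 < ε / 2 := by positivity
    have hsub : ∀ z ∈ Metric.ball p (ε / 2), Metric.closedBall z (ε / 4) ⊆ interior S := by
      intro z hz w hw
      refine hball ?_
      rw [Metric.mem_ball] at hz ⊢
      rw [Metric.mem_closedBall] at hw
      linarith [dist_triangle w z p]
    have hzS : ∀ z ∈ Metric.ball p (ε / 2), z ∈ interior S := fun z hz =>
      hsub z hz (Metric.mem_closedBall_self (by positivity))
    have hder : ∀ᵐ t ∂μ, ∀ z ∈ Metric.ball p (ε / 2),
        HasDerivAt (fun q => F q t) (deriv (fun q => F q t) z) z := by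
      filter_upwards [hF] with t ht z hz
      exact (ht.2.differentiableAt (isOpen_interior.mem_nhds (hzS z hz))).hasDerivAt
    have hlim : Tendsto (fun n : ℕ => ((n : ℂ) + 1)⁻¹) atTop (𝓝[≠] 0) := by
      rw [tendsto_nhdsWithin_iff]
      refine ⟨?_, Eventually.of_forall fun n => inv_ne_zero (Nat.cast_add_one_ne_zero n)⟩
      simpa [one_div] using tendsto_one_div_add_atTop_nhds_zero_nat (𝕜 := ℂ)
    have hlim0 : Tendsto (fun n : ℕ => p + ((n : ℂ) + 1)⁻¹) atTop (𝓝 p) := by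
      simpa using tendsto_const_nhds.add (hlim.mono_right nhdsWithin_le_nhds)
    obtain ⟨N, hN⟩ := eventually_atTop.1 (hlim0.eventually (isOpen_interior.mem_nhds hp))
    -- Measurability in `t` of the derivative: it is a limit of difference quotients along a
    -- sequence.
    have hmeas : AEStronglyMeasurable (fun t => deriv (fun q => F q t) p) μ := by
      refine aestronglyMeasurable_of_tendsto_ae atTop (f := fun (n : ℕ) t =>
        (((n + N : ℕ) : ℂ) + 1)⁻¹⁻¹ • (F (p + (((n + N : ℕ) : ℂ) + 1)⁻¹) t - F p t))
        (fun n => ?_) ?_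
      · exact ((hm _ (interior_subset (hN (n + N) (by omega)))).sub
          (hm _ (interior_subset hp))).const_smul (((n + N : ℕ) : ℂ) + 1)⁻¹⁻¹
      · filter_upwards [hder] with t ht
        have h1 := (hasDerivAt_iff_tendsto_slope_zero.1 (ht p (Metric.mem_ball_self hε2))).comp
          (hlim.comp (tendsto_add_atTop_nat N))
        exact h1
    refine ((hasDerivAt_integral_of_dominated_loc_of_deriv_le (bound := fun t => b t / (ε / 4))
      (F' := fun z t => deriv (fun q => F q t) z) (Metric.ball_mem_nhds p hε2) ?_ ?_ hmeas ?_
      (hi.div_const _) hder).2).differentiableAt.differentiableWithinAt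
    · filter_upwards [isOpen_interior.mem_nhds hp] with z hz using hm z (interior_subset hz)
    · exact hi.mono' (hm p (interior_subset hp)) (hb.mono fun t ht => ht p (interior_subset hp))
    · filter_upwards [hb, hF] with t ht hFt z hz
      refine Complex.norm_deriv_le_of_forall_mem_sphere_norm_le (by positivity) ?_ ?_
      · exact (hFt.2.mono (hsub z hz)).diffContOnCl_ball subset_rfl
      · intro w hw
        exact ht w (interior_subset (hsub z hz (Metric.sphere_subset_closedBall hw)))

end HolCont

/-! ### Linear Volterra equations with a parameter. -/

/-- Solution of a linear Volterra equation with a parameter by successive approximations. -/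
theorem exists_volterra_solution {ι : Type*} [Fintype ι] {S : Set ℂ} {I : Set ℝ} {J : ℝ → Set ℝ} (hJ : ∀ x ∈ I, J x ⊆ I)
    (hJm : ∀ x, MeasurableSet (J x)) {k : ℂ → ℝ → ℝ → ι → ι → ℂ} {m : ℝ → ℝ}
    (hkm : ∀ p ∈ S, ∀ x ∈ I, ∀ i j,
      AEStronglyMeasurable (fun t => k p x t i j) (volume.restrict (J x)))
    (hkb : ∀ p ∈ S, ∀ x ∈ I, ∀ t ∈ J x, ∀ i j, ‖k p x t i j‖ ≤ m t)
    (hkh : ∀ x ∈ I, ∀ t ∈ J x, ∀ i j, HolCont S (fun p => k p x t i j))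
    (hm : ∀ x ∈ I, IntegrableOn m (J x))
    (hkc : ∀ p ∈ S, ∀ (g : ℝ → ι → ℂ) (C : ℝ), (∀ j, ContinuousOn (fun t => g t j) I) →
      (∀ t ∈ I, ∀ j, ‖g t j‖ ≤ C) →
      ∀ i, ContinuousOn (fun x => ∫ t in J x, ∑ j, k p x t i j * g t j) I)
    {b : ℕ → ℝ → ℝ} {β : ℕ → ℝ} (hbm : ∀ n, ContinuousOn (b n) I)
    (hb : ∀ n, ∀ x ∈ I, Fintype.card ι * ∫ t in J x, m t * b n t ≤ b (n + 1) x)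
    (hbβ : ∀ n, ∀ x ∈ I, b n x ≤ β n) (hβ : Summable β)
    {f₀ : ℂ → ℝ → ι → ℂ} (hfc : ∀ p ∈ S, ∀ i, ContinuousOn (fun x => f₀ p x i) I)
    (hfh : ∀ x ∈ I, ∀ i, HolCont S (fun p => f₀ p x i))
    (hfb : ∀ p ∈ S, ∀ x ∈ I, ∀ i, ‖f₀ p x i‖ ≤ b 0 x) :
    ∃ f : ℂ → ℝ → ι → ℂ, (∀ p ∈ S, ∀ i, ContinuousOn (fun x => f p x i) I) ∧
      (∀ p ∈ S, ∀ x ∈ I, ∀ i, ‖f p x i‖ ≤ ∑' n, β n) ∧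
      (∀ x ∈ I, ∀ i, HolCont S (fun p => f p x i)) ∧
      ∀ p ∈ S, ∀ x ∈ I, ∀ i, f p x i = f₀ p x i + ∫ t in J x, ∑ j, k p x t i j * f p t j := by
  -- Terms of the Neumann series; the n-th is dominated by `b n`. The set `J x` is the segment
  -- between a and x in one application and (x,∞) in the other, which is why the continuity of the
  -- integral operator is left as a hypothesis.
  let F : ℕ → ℂ → ℝ → ι → ℂ := fun n => Nat.rec f₀
    (fun _ G p x i => ∫ t in J x, ∑ j, k p x t i j * G p t j) n
  have hF0 : F 0 = f₀ := rfl
  have hFs : ∀ n p x i, F (n + 1) p x i = ∫ t in J x, ∑ j, k p x t i j * F n p t j :=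
    fun _ _ _ _ => rfl
  have main : ∀ n, (∀ p ∈ S, ∀ i, ContinuousOn (fun x => F n p x i) I) ∧
      (∀ x ∈ I, ∀ i, HolCont S (fun p => F n p x i)) ∧
      (∀ p ∈ S, ∀ x ∈ I, ∀ i, ‖F n p x i‖ ≤ b n x) := by
    intro n
    induction n with
    | zero => exact ⟨hfc, hfh, hfb⟩
    | succ n ih =>
      obtain ⟨hc, hh, hbd⟩ := ih
      have meas : ∀ p ∈ S, ∀ x ∈ I, ∀ i, AEStronglyMeasurable
          (fun t => ∑ j, k p x t i j * F n p t j) (volume.restrict (J x)) := by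
        intro p hp x hx i
        refine Finset.aestronglyMeasurable_fun_sum _ fun j _ => (hkm p hp x hx i j).mul ?_
        exact ((hc p hp j).mono (hJ x hx)).aestronglyMeasurable (hJm x)
      have bound : ∀ p ∈ S, ∀ x ∈ I, ∀ i, ∀ t ∈ J x,
          ‖∑ j, k p x t i j * F n p t j‖ ≤ Fintype.card ι * (m t * b n t) := by
        intro p hp x hx i t ht
        refine (norm_sum_le _ _).trans ?_
        refine (Finset.sum_le_card_nsmul _ _ (m t * b n t) fun j _ => ?_).trans
          (by simp)
        rw [norm_mul]
        have h1 := hkb p hp x hx t ht i j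
        exact mul_le_mul h1 (hbd p hp t (hJ x hx ht) j) (norm_nonneg _)
          ((norm_nonneg _).trans h1)
      refine ⟨fun p hp i => hkc p hp (F n p) (β n) (hc p hp)
        (fun t ht j => (hbd p hp t ht j).trans (hbβ n t ht)) i, ?_, ?_⟩
      all_goals
        -- Nonnegativity of `b n` is known only through the norm bound, which needs a parameter in
        -- `S` and an index.
        have integ : S.Nonempty → Nonempty ι → ∀ x ∈ I, Integrable (fun t =>
            Fintype.card ι * (m t * b n t)) (volume.restrict (J x)) := by
          rintro ⟨p, hp⟩ ⟨i⟩ x hx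
          refine Integrable.const_mul ?_ _
          refine Integrable.mul_bdd (c := β n) (hm x hx)
            (((hbm n).mono (hJ x hx)).aestronglyMeasurable (hJm x)) ?_
          refine (ae_restrict_iff' (hJm x)).2 (Eventually.of_forall fun t ht => ?_)
          have h0 := (norm_nonneg _).trans (hbd p hp t (hJ x hx ht) i)
          rw [Real.norm_of_nonneg h0]
          exact hbβ n t (hJ x hx ht)
      · intro x hx i
        rcases S.eq_empty_or_nonempty with rfl | hS
        · exact ⟨continuousOn_empty _, by rw [interior_empty]; exact differentiableOn_empty⟩
        refine HolCont.integral (fun p hp => meas p hp x hx i)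
          ((ae_restrict_iff' (hJm x)).2 (Eventually.of_forall fun t ht p hp =>
            bound p hp x hx i t ht))
          ((ae_restrict_iff' (hJm x)).2 (Eventually.of_forall fun t ht =>
            HolCont.sum fun j _ => (hkh x hx t ht i j).mul (hh t (hJ x hx ht) j)))
          (integ hS ⟨i⟩ x hx)
      · intro p hp x hx i
        refine (norm_integral_le_of_norm_le (integ ⟨p, hp⟩ ⟨i⟩ x hx)
          ((ae_restrict_iff' (hJm x)).2 (Eventually.of_forall fun t ht =>
            bound p hp x hx i t ht))).trans ?_
        rw [integral_const_mul]
        exact hb n x hx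
  have hFβ : ∀ n, ∀ p ∈ S, ∀ x ∈ I, ∀ i, ‖F n p x i‖ ≤ β n := fun n p hp x hx i =>
    ((main n).2.2 p hp x hx i).trans (hbβ n x hx)
  have hsum : ∀ p ∈ S, ∀ x ∈ I, ∀ i, Summable fun n => F n p x i := fun p hp x hx i =>
    Summable.of_norm_bounded hβ fun n => hFβ n p hp x hx i
  refine ⟨fun p x i => ∑' n, F n p x i, fun p hp i => ?_, fun p hp x hx i => ?_,
    fun x hx i => ?_, fun p hp x hx i => ?_⟩
  · exact continuousOn_tsum (fun n => (main n).1 p hp i) hβ fun n x hx => hFβ n p hp x hx i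
  · exact tsum_of_norm_bounded hβ.hasSum fun n => hFβ n p hp x hx i
  · exact HolCont.tsum hβ (fun n => (main n).2.1 x hx i) fun n p hp => hFβ n p hp x hx i
  · show ∑' n, F n p x i = _
    rw [(hsum p hp x hx i).tsum_eq_zero_add, hF0]
    congr 1
    simp only [hFs]
    refine (hasSum_integral_of_dominated_convergence
      (fun n t => Fintype.card ι * (m t * β n)) (fun n => ?_) (fun n => ?_) ?_ ?_ ?_).tsum_eq
    · refine Finset.aestronglyMeasurable_fun_sum _ fun j _ => (hkm p hp x hx i j).mul ?_
      exact (((main n).1 p hp j).mono (hJ x hx)).aestronglyMeasurable (hJm x)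
    · refine (ae_restrict_iff' (hJm x)).2 (Eventually.of_forall fun t ht => ?_)
      refine (norm_sum_le _ _).trans ?_
      refine (Finset.sum_le_card_nsmul _ _ (m t * β n) fun j _ => ?_).trans (by simp)
      rw [norm_mul]
      have h1 := hkb p hp x hx t ht i j
      exact mul_le_mul h1 (hFβ n p hp t (hJ x hx ht) j) (norm_nonneg _)
        ((norm_nonneg _).trans h1)
    · exact Eventually.of_forall fun t => (hβ.mul_left _).mul_left _
    · simp only [tsum_mul_left]
      exact Integrable.const_mul (Integrable.mul_const (hm x hx) _) _
    · refine (ae_restrict_iff' (hJm x)).2 (Eventually.of_forall fun t ht => ?_)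
      exact hasSum_sum fun j _ => (hsum p hp t (hJ x hx ht) j).hasSum.mul_left _

/-! ### Entire power series and their products with a complex power. -/

/-- The coefficients of an everywhere convergent power series. -/
def IsEntireCoeff (b : ℕ → ℂ) : Prop := ∀ r : ℝ, 0 ≤ r → Summable fun k => ‖b k‖ * r ^ k

/-- The sum of a power series. -/
def powSeries (b : ℕ → ℂ) (z : ℂ) : ℂ := ∑' k, b k * z ^ k

namespace IsEntireCoeff

variable {b : ℕ → ℂ}

theorem summable (hb : IsEntireCoeff b) (z : ℂ) : Summable fun k => b k * z ^ k := by
  refine Summable.of_norm ?_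
  simpa using hb ‖z‖ (norm_nonneg z)

/-- The factor 2k + m is the effect of x d/dx on the k-th term of x^m Σ b_k (λx²)^k. It is at most
(2 + |m|)2^k in modulus, which only doubles the radius. -/
theorem mul_linear (hb : IsEntireCoeff b) (m : ℂ) :
    IsEntireCoeff fun k => (2 * (k : ℂ) + m) * b k := by
  intro r hr
  refine Summable.of_nonneg_of_le (fun k => by positivity) (fun k => ?_)
    ((hb (2 * r) (by positivity)).mul_left (2 + ‖m‖))
  rw [norm_mul, mul_pow]
  have h1 : ‖2 * (k : ℂ) + m‖ ≤ (2 + ‖m‖) * 2 ^ k := by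
    have hk : (k : ℝ) ≤ 2 ^ k := by exact_mod_cast Nat.lt_two_pow_self.le
    have hk1 : (1 : ℝ) ≤ 2 ^ k := one_le_pow₀ (by norm_num)
    have : ‖2 * (k : ℂ) + m‖ ≤ 2 * k + ‖m‖ := by
      refine (norm_add_le _ _).trans ?_
      simp
    nlinarith [norm_nonneg m]
  have h2 : 0 ≤ ‖b k‖ * r ^ k := by positivity
  calc ‖2 * (k : ℂ) + m‖ * ‖b k‖ * r ^ k = ‖2 * (k : ℂ) + m‖ * (‖b k‖ * r ^ k) := by ring
    _ ≤ (2 + ‖m‖) * 2 ^ k * (‖b k‖ * r ^ k) := by gcongr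
    _ = _ := by ring

theorem hasSum_deriv (hb : IsEntireCoeff b) (z : ℂ) :
    HasSum (fun k => b k * (k * z ^ (k - 1))) (deriv (powSeries b) z) ∧
      DifferentiableAt ℂ (powSeries b) z := by
  have hz : z ∈ Metric.ball (0 : ℂ) (‖z‖ + 1) := by simp
  have hd : ∀ k, DifferentiableOn ℂ (fun w : ℂ => b k * w ^ k) (Metric.ball 0 (‖z‖ + 1)) :=
    fun k => by fun_prop
  have hle : ∀ k, ∀ w ∈ Metric.ball (0 : ℂ) (‖z‖ + 1), ‖b k * w ^ k‖ ≤
      ‖b k‖ * (‖z‖ + 1) ^ k := by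
    intro k w hw
    rw [norm_mul, norm_pow]
    have : ‖w‖ ≤ ‖z‖ + 1 := by simpa using (mem_ball_zero_iff.1 hw).le
    gcongr
  have hs := hb (‖z‖ + 1) (by positivity)
  constructor
  · have h := Complex.hasSum_deriv_of_summable_norm hs hd Metric.isOpen_ball hle hz
    rw [show powSeries b = fun w => ∑' k, b k * w ^ k from rfl]
    simpa using! h
  · exact (Complex.differentiableOn_tsum_of_summable_norm hs hd Metric.isOpen_ball
      hle).differentiableAt (Metric.isOpen_ball.mem_nhds hz)

theorem differentiable (hb : IsEntireCoeff b) : Differentiable ℂ (powSeries b) :=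
  fun z => (hb.hasSum_deriv z).2

theorem powSeries_mul_linear (hb : IsEntireCoeff b) (m z : ℂ) :
    powSeries (fun k => (2 * (k : ℂ) + m) * b k) z =
      m * powSeries b z + 2 * (z * deriv (powSeries b) z) := by
  have h1 := ((hb.summable z).hasSum.mul_left m).add
    (((hb.hasSum_deriv z).1.mul_left z).mul_left 2)
  rw [powSeries, powSeries, ← h1.tsum_eq]
  refine tsum_congr fun k => ?_
  rcases k with _ | k
  · simp
  · simp only [Nat.add_sub_cancel]
    push_cast
    ring

theorem norm_powSeries_le (hb : IsEntireCoeff b) {r : ℝ} {z : ℂ} (hz : ‖z‖ ≤ r) :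
    ‖powSeries b z‖ ≤ ∑' k, ‖b k‖ * r ^ k := by
  have hr := (norm_nonneg z).trans hz
  refine tsum_of_norm_bounded (hb r hr).hasSum fun k => ?_
  rw [norm_mul, norm_pow]
  gcongr

/-- Negative `x` is allowed: along the negative half-line the argument is constantly π, so the
principal power is differentiable there. Both sides of the singular point are thus handled at once.
-/
theorem hasDerivAt_cpow_mul (hb : IsEntireCoeff b) (m lam : ℂ) {x : ℝ} (hx : x ≠ 0) :
    HasDerivAt (fun y : ℝ => (y : ℂ) ^ m * powSeries b (lam * (y : ℂ) ^ 2))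
      ((x : ℂ) ^ (m - 1) * powSeries (fun k => (2 * (k : ℂ) + m) * b k) (lam * (x : ℂ) ^ 2)) x := by
  have hx' : (x : ℂ) ≠ 0 := by exact_mod_cast hx
  have h1 : HasDerivAt (fun y : ℝ => (y : ℂ) ^ m) (m * (x : ℂ) ^ (m - 1)) x := by
    rcases eq_or_ne m 0 with rfl | hm
    · simpa using hasDerivAt_const x (1 : ℂ)
    · exact hasDerivAt_ofReal_cpow_const hx hm
  have h2 : HasDerivAt (fun y : ℝ => lam * (y : ℂ) ^ 2) (lam * (2 * (x : ℂ))) x := by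
    have := ((Complex.ofRealCLM.hasDerivAt (x := x)).pow 2).const_mul lam
    simpa using this
  have h3 := (hb.differentiable (lam * (x : ℂ) ^ 2)).hasDerivAt.comp x h2
  refine (h1.mul h3).congr_deriv ?_
  rw [hb.powSeries_mul_linear, ← sub_add_cancel m 1, Complex.cpow_add _ _ hx', add_sub_cancel_right,
    Complex.cpow_one]
  simp only [Function.comp_apply]
  ring

end IsEntireCoeff

/-! ### The solutions C_j of the equation with q = 0. -/

namespace SLProblem

/-- The standing assumptions on the problem that do not concern the transition matrix. -/
structure Admissible (P : SLProblem) : Prop where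
  a_pos : 0 < P.a
  ν_re_pos : 0 < P.ν.re
  ν_ne : ∀ n : ℕ, 0 < n → P.ν ≠ (n : ℂ)
  c₀_mul : P.c₀ 0 * P.c₀ 1 = (2 * P.ν)⁻¹
  potential : P.PotentialInW

variable {P : SLProblem}

theorem μ_zero : P.μ 0 = -P.ν + 1 / 2 := by simp [μ]

theorem μ_one : P.μ 1 = P.ν + 1 / 2 := by simp [μ]

theorem μ_add : P.μ 0 + P.μ 1 = 1 := by rw [μ_zero, μ_one]; ring

theorem μ_indicial (j : Fin 2) : P.μ j * (P.μ j - 1) = P.ν₀ := by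
  fin_cases j
  · simp only [Fin.zero_eta, μ_zero, ν₀]; ring
  · simp only [Fin.mk_one, μ_one, ν₀]; ring

theorem indicial_eq (j : Fin 2) (s : ℂ) :
    (2 * s + P.μ j) * (2 * s + P.μ j - 1) - P.ν₀ = 2 * s * (2 * s + 2 * P.μ j - 1) := by
  rw [← μ_indicial j]; ring

/-- The expression factors as 2s(2s ∓ 2ν); that ν is not a positive integer excludes a zero for the
first exponent, and Re ν > 0 for the second. -/
theorem Admissible.indicial_ne_zero (h : P.Admissible) (j : Fin 2) {s : ℕ} (hs : 0 < s) :
    (2 * (s : ℂ) + P.μ j) * (2 * (s : ℂ) + P.μ j - 1) - P.ν₀ ≠ 0 := by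
  have hs' : (s : ℂ) ≠ 0 := by exact_mod_cast hs.ne'
  rw [indicial_eq]
  refine mul_ne_zero (mul_ne_zero two_ne_zero hs') ?_
  fin_cases j
  · simp only [Fin.zero_eta, μ_zero]
    intro h0
    exact h.ν_ne s hs (by linear_combination (-1 / 2) * h0)
  · simp only [Fin.mk_one, μ_one]
    intro h0
    have h1 : (s : ℂ) + P.ν = 0 := by linear_combination (1 / 2) * h0
    have h2 := congrArg Complex.re h1
    simp only [Complex.add_re, Complex.natCast_re, Complex.zero_re] at h2
    have := h.ν_re_pos
    have : (0 : ℝ) ≤ s := Nat.cast_nonneg s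
    linarith

theorem coeff_succ (j : Fin 2) (k : ℕ) : P.coeff j (k + 1) =
    -P.coeff j k * ((2 * ((k + 1 : ℕ) : ℂ) + P.μ j) * (2 * ((k + 1 : ℕ) : ℂ) + P.μ j - 1)
      - P.ν₀)⁻¹ := by
  rw [coeff, coeff, Finset.prod_Icc_succ_top (by omega), mul_inv, pow_succ]
  ring

theorem Admissible.coeff_succ_mul (h : P.Admissible) (j : Fin 2) (k : ℕ) :
    ((2 * ((k + 1 : ℕ) : ℂ) + P.μ j) * (2 * ((k + 1 : ℕ) : ℂ) + P.μ j - 1) - P.ν₀) *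
      P.coeff j (k + 1) = -P.coeff j k := by
  rw [coeff_succ, mul_comm, mul_assoc, inv_mul_cancel₀ (h.indicial_ne_zero j k.succ_pos), mul_one]

theorem isEntireCoeff_coeff (P : SLProblem) (j : Fin 2) : IsEntireCoeff (P.coeff j) := by
  intro r hr
  -- `N` is so large that |D| ≥ 2(r + 1) for k ≥ N, whence consecutive terms have ratio at most 1/2.
  obtain ⟨N, hN⟩ := exists_nat_gt (‖2 * P.μ j - 1‖ + 1 + r)
  refine summable_of_ratio_norm_eventually_le (r := 1 / 2) (by norm_num) ?_
  filter_upwards [eventually_ge_atTop N] with k hk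
  have hk' : (N : ℝ) ≤ k := by exact_mod_cast hk
  rw [coeff_succ, indicial_eq]
  set D := 2 * ((k + 1 : ℕ) : ℂ) * (2 * ((k + 1 : ℕ) : ℂ) + 2 * P.μ j - 1)
  have hD : 2 * (r + 1) ≤ ‖D‖ := by
    have h1 : ‖2 * ((k + 1 : ℕ) : ℂ)‖ = 2 * (k + 1) := by
      rw [norm_mul, Complex.norm_natCast]; simp
    have h2 : 1 ≤ ‖2 * ((k + 1 : ℕ) : ℂ) + 2 * P.μ j - 1‖ := by
      have := norm_sub_le (2 * ((k + 1 : ℕ) : ℂ) + 2 * P.μ j - 1) (2 * P.μ j - 1)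
      rw [show 2 * ((k + 1 : ℕ) : ℂ) + 2 * P.μ j - 1 - (2 * P.μ j - 1) = 2 * ((k + 1 : ℕ) : ℂ) by
        ring, h1] at this
      linarith [norm_nonneg (2 * P.μ j - 1)]
    rw [norm_mul, h1]
    nlinarith [norm_nonneg (2 * P.μ j - 1)]
  have hDi : ‖D‖⁻¹ * r ≤ 1 / 2 := by
    rw [inv_mul_le_iff₀ (by linarith)]
    linarith
  simp only [norm_mul, norm_neg, norm_inv, norm_norm, norm_pow, Real.norm_of_nonneg hr, pow_succ]
  calc ‖P.coeff j k‖ * ‖D‖⁻¹ * (r ^ k * r) = (‖D‖⁻¹ * r) * (‖P.coeff j k‖ * r ^ k) := by ring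
    _ ≤ _ := by gcongr

theorem C_eq (j : Fin 2) (x : ℝ) (lam : ℂ) : P.C j x lam =
    ((x - P.a : ℝ) : ℂ) ^ P.μ j * powSeries (P.coeff j) (lam * ((x - P.a : ℝ) : ℂ) ^ 2) := by
  rw [C, powSeries]
  congr 1
  refine tsum_congr fun k => ?_
  rw [mul_pow, pow_mul]

/-- The derivative of `C_j(x, λ)` with respect to `x`. -/
def dC (P : SLProblem) (j : Fin 2) (x : ℝ) (lam : ℂ) : ℂ :=
  ((x - P.a : ℝ) : ℂ) ^ (P.μ j - 1) *
    powSeries (fun k => (2 * (k : ℂ) + P.μ j) * P.coeff j k) (lam * ((x - P.a : ℝ) : ℂ) ^ 2)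

/-- The potential of the equation without the spectral parameter. -/
def V (P : SLProblem) (x : ℝ) : ℂ := P.ν₀ / ((x - P.a : ℝ) : ℂ) ^ 2 + P.q x

theorem hasDerivAt_C (j : Fin 2) {x : ℝ} (hx : x ≠ P.a) (lam : ℂ) :
    HasDerivAt (fun y => P.C j y lam) (P.dC j x lam) x := by
  have := ((P.isEntireCoeff_coeff j).hasDerivAt_cpow_mul (P.μ j) lam (sub_ne_zero.2 hx)).comp_sub_const
    x P.a
  simp only [C_eq]
  exact this

theorem Admissible.hasDerivAt_dC (h : P.Admissible) (j : Fin 2) {x : ℝ} (hx : x ≠ P.a) (lam : ℂ) :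
    HasDerivAt (fun y => P.dC j y lam)
      ((P.ν₀ / ((x - P.a : ℝ) : ℂ) ^ 2 - lam) * P.C j x lam) x := by
  have hb := P.isEntireCoeff_coeff j
  have hx' : ((x - P.a : ℝ) : ℂ) ≠ 0 := by exact_mod_cast sub_ne_zero.2 hx
  refine ((hb.mul_linear (P.μ j)).hasDerivAt_cpow_mul (P.μ j - 1) lam
    (sub_ne_zero.2 hx)).comp_sub_const x P.a |>.congr_deriv ?_
  set z := lam * ((x - P.a : ℝ) : ℂ) ^ 2 with hz
  -- Comparison of powers of z: the constant term is the indicial equation, the others are the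
  -- recursion for the coefficients.
  have key : powSeries (fun k => (2 * (k : ℂ) + (P.μ j - 1)) *
      ((2 * (k : ℂ) + P.μ j) * P.coeff j k)) z = (P.ν₀ - z) * powSeries (P.coeff j) z := by
    have hs := (((hb.mul_linear (P.μ j)).mul_linear (P.μ j - 1)).summable z)
    rw [sub_mul, powSeries, powSeries, hs.tsum_eq_zero_add, ← tsum_mul_left, ← tsum_mul_left,
      ((hb.summable z).mul_left P.ν₀).tsum_eq_zero_add, add_sub_assoc,
      ← (((summable_nat_add_iff 1).2 (hb.summable z)).mul_left P.ν₀).tsum_sub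
        ((hb.summable z).mul_left z)]
    congr 1
    · rw [← μ_indicial j]; push_cast; ring
    · refine tsum_congr fun k => ?_
      have := h.coeff_succ_mul j k
      linear_combination z ^ (k + 1) * this
  rw [key, C_eq, ← hz, show P.μ j = (P.μ j - 1 - 1) + 2 by ring, Complex.cpow_add _ _ hx',
    show P.μ j - 1 - 1 + 2 - 1 - 1 = P.μ j - 1 - 1 by ring,
    hz]
  rw [show (2 : ℂ) = ((2 : ℕ) : ℂ) by norm_num, Complex.cpow_natCast]
  field_simp

theorem differentiable_C (j : Fin 2) (x : ℝ) : Differentiable ℂ fun lam => P.C j x lam := by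
  simp only [C_eq]
  exact ((P.isEntireCoeff_coeff j).differentiable.comp
    (differentiable_id.mul_const _)).const_mul _

theorem differentiable_dC (j : Fin 2) (x : ℝ) : Differentiable ℂ fun lam => P.dC j x lam :=
  (((P.isEntireCoeff_coeff j).mul_linear _).differentiable.comp
    (differentiable_id.mul_const _)).const_mul _

theorem Admissible.ν_ne_zero (h : P.Admissible) : P.ν ≠ 0 := by
  intro h0
  have := h.ν_re_pos
  simp [h0] at this

/-- Because μ₁ + μ₂ = 1 the powers cancel, leaving an entire function of λ(x-a)². Its derivative in
x vanishes for x ≠ a by the equation and at x = a since (x-a)² is stationary there. So it is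
constant across a, with value c₁₀c₂₀(μ₂ - μ₁) = 1 at x = a. -/
theorem Admissible.wronskian_C (h : P.Admissible) {x : ℝ} (hx : x ≠ P.a) (lam : ℂ) :
    P.C 0 x lam * P.dC 1 x lam - P.dC 0 x lam * P.C 1 x lam = 1 := by
  let e := fun j : Fin 2 => powSeries (P.coeff j)
  let d := fun j : Fin 2 => powSeries fun k => (2 * (k : ℂ) + P.μ j) * P.coeff j k
  have he : ∀ j, Differentiable ℂ (e j) := fun j => (P.isEntireCoeff_coeff j).differentiable
  have hd : ∀ j, Differentiable ℂ (d j) := fun j =>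
    ((P.isEntireCoeff_coeff j).mul_linear _).differentiable
  let w : ℂ → ℂ := fun z => e 0 z * d 1 z - d 0 z * e 1 z
  have hw : Differentiable ℂ w := ((he 0).mul (hd 1)).sub ((hd 0).mul (he 1))
  have hW : ∀ y, y ≠ P.a → P.C 0 y lam * P.dC 1 y lam - P.dC 0 y lam * P.C 1 y lam =
      w (lam * ((y - P.a : ℝ) : ℂ) ^ 2) := by
    intro y hy
    have hy' : ((y - P.a : ℝ) : ℂ) ≠ 0 := by exact_mod_cast sub_ne_zero.2 hy
    have e1 : ((y - P.a : ℝ) : ℂ) ^ P.μ 0 * ((y - P.a : ℝ) : ℂ) ^ (P.μ 1 - 1) = 1 := by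
      rw [← Complex.cpow_add _ _ hy', show P.μ 0 + (P.μ 1 - 1) = 0 by rw [← add_sub_assoc, μ_add,
        sub_self], Complex.cpow_zero]
    have e2 : ((y - P.a : ℝ) : ℂ) ^ (P.μ 0 - 1) * ((y - P.a : ℝ) : ℂ) ^ P.μ 1 = 1 := by
      rw [← Complex.cpow_add _ _ hy', show P.μ 0 - 1 + P.μ 1 = 0 by rw [sub_add_eq_add_sub, μ_add,
        sub_self], Complex.cpow_zero]
    simp only [C_eq, dC, w, e, d]
    generalize lam * ((y - P.a : ℝ) : ℂ) ^ 2 = z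
    linear_combination (powSeries (P.coeff 0) z *
        powSeries (fun k => (2 * (k : ℂ) + P.μ 1) * P.coeff 1 k) z) * e1 -
      (powSeries (P.coeff 1) z *
        powSeries (fun k => (2 * (k : ℂ) + P.μ 0) * P.coeff 0 k) z) * e2
  let f : ℝ → ℂ := fun y => w (lam * ((y - P.a : ℝ) : ℂ) ^ 2)
  have hf : ∀ y, HasDerivAt f 0 y := by
    intro y
    rcases eq_or_ne y P.a with rfl | hy
    · have h2 : HasDerivAt (fun y : ℝ => lam * ((y - P.a : ℝ) : ℂ) ^ 2)
          (lam * (2 * ((P.a - P.a : ℝ) : ℂ))) P.a := by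
        have := (((Complex.ofRealCLM.hasDerivAt (x := P.a - P.a)).pow 2).const_mul
          lam).comp_sub_const P.a P.a
        simpa using this
      have h3 := (hw (lam * ((P.a - P.a : ℝ) : ℂ) ^ 2)).hasDerivAt.comp P.a h2
      simpa [f, Function.comp_def] using h3
    · have h1 := ((hasDerivAt_C 0 hy lam).mul (h.hasDerivAt_dC 1 hy lam)).sub
        ((h.hasDerivAt_dC 0 hy lam).mul (hasDerivAt_C 1 hy lam))
      refine (h1.congr_of_eventuallyEq ?_).congr_deriv (by ring)
      filter_upwards [isOpen_ne.mem_nhds hy] with z hz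
      exact (hW z hz).symm
  rw [hW x hx]
  have hconst := is_const_of_deriv_eq_zero (fun y => (hf y).differentiableAt)
    (fun y => (hf y).deriv) x P.a
  have hν := h.ν_ne_zero
  have hp0 : ∀ b : ℕ → ℂ, powSeries b 0 = b 0 := by
    intro b
    rw [powSeries, tsum_eq_single 0 fun k hk => by simp [hk]]
    simp
  change f x = 1
  rw [hconst]
  simp only [f, w, e, d, sub_self, Complex.ofReal_zero, ne_eq, OfNat.ofNat_ne_zero,
    not_false_eq_true, zero_pow, mul_zero, hp0, coeff]
  simp only [μ_zero, μ_one]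
  have hc := h.c₀_mul
  have : P.c₀ 0 * P.c₀ 1 * (2 * P.ν) = 1 := by rw [hc]; field_simp
  simp
  linear_combination this

theorem norm_cpow_ofReal_le (x : ℝ) (hx : x ≠ 0) (m : ℂ) :
    ‖(x : ℂ) ^ m‖ ≤ Real.exp (Real.pi * |m.im|) * |x| ^ m.re := by
  have hx' : (x : ℂ) ≠ 0 := by exact_mod_cast hx
  rw [Complex.norm_cpow_of_ne_zero hx', Complex.norm_real, Real.norm_eq_abs, div_eq_mul_inv,
    ← Real.exp_neg, mul_comm]
  gcongr
  have h1 := Complex.abs_arg_le_pi (x : ℂ)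
  have h2 := neg_abs_le (Complex.arg x * m.im)
  rw [abs_mul] at h2
  have h3 : |Complex.arg x| * |m.im| ≤ Real.pi * |m.im| := by gcongr
  linarith

/-- The exponent of the weight in the class of potentials. -/
def κ (P : SLProblem) : ℝ := min 0 (1 - 2 * P.ν.re)

/-- The real parts of μ_i + μ_j are 1 - 2 Re ν, 1 and 1 + 2 Re ν, all at least κ; the excess power
is bounded on |x-a| ≤ R. -/
theorem Admissible.exists_norm_C_mul_C_le (h : P.Admissible) (R r : ℝ) :
    ∃ K, 0 ≤ K ∧ ∀ lam : ℂ, ‖lam‖ ≤ r → ∀ x, x ≠ P.a → |x - P.a| ≤ R → ∀ i j : Fin 2,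
      ‖P.C i x lam * P.C j x lam‖ ≤ K * |x - P.a| ^ P.κ := by
  rcases lt_or_ge r 0 with hr | hr
  · exact ⟨0, le_rfl, fun lam hl => absurd (norm_nonneg lam) (by linarith)⟩
  rcases lt_or_ge R 0 with hR | hR
  · exact ⟨0, le_rfl, fun _ _ x _ hxR => absurd (abs_nonneg (x - P.a)) (by linarith)⟩
  let B := fun j : Fin 2 => ∑' k, ‖P.coeff j k‖ * (r * R ^ 2) ^ k
  let E := fun i j : Fin 2 => Real.exp (Real.pi * |(P.μ i + P.μ j).im|)
  let Q := fun i j : Fin 2 => R ^ ((P.μ i + P.μ j).re - P.κ)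
  have hB : ∀ j, 0 ≤ B j := fun j => tsum_nonneg fun k => by positivity
  have hnn : ∀ i j, 0 ≤ E i j * Q i j * (B i * B j) := fun i j => by
    have := hB i; have := hB j
    positivity
  refine ⟨∑ i, ∑ j, E i j * Q i j * (B i * B j),
    Finset.sum_nonneg fun i _ => Finset.sum_nonneg fun j _ => hnn i j,
    fun lam hl x hx hxR i j => ?_⟩
  have hx' : x - P.a ≠ 0 := sub_ne_zero.2 hx
  have hx'' : ((x - P.a : ℝ) : ℂ) ≠ 0 := by exact_mod_cast hx'
  have hpos : 0 < |x - P.a| := abs_pos.2 hx'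
  have hz : ‖lam * ((x - P.a : ℝ) : ℂ) ^ 2‖ ≤ r * R ^ 2 := by
    rw [norm_mul, norm_pow, Complex.norm_real, Real.norm_eq_abs]
    gcongr
  have hκ : P.κ ≤ (P.μ i + P.μ j).re := by
    have h1 : P.κ ≤ 1 - 2 * P.ν.re := min_le_right _ _
    have h2 := h.ν_re_pos
    fin_cases i <;> fin_cases j <;>
      simp only [Fin.zero_eta, Fin.mk_one, μ_zero, μ_one, Complex.add_re, Complex.neg_re,
        Complex.div_re, Complex.one_re, Complex.re_ofNat, Complex.normSq_ofNat, Complex.im_ofNat] <;>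
      norm_num <;> linarith
  have hpow : |x - P.a| ^ (P.μ i + P.μ j).re ≤ Q i j * |x - P.a| ^ P.κ := by
    calc |x - P.a| ^ (P.μ i + P.μ j).re
        = |x - P.a| ^ ((P.μ i + P.μ j).re - P.κ) * |x - P.a| ^ P.κ := by
          rw [← Real.rpow_add hpos]; congr 1; ring
      _ ≤ _ := by
          gcongr
          exact Real.rpow_le_rpow hpos.le hxR (by linarith)
  have hb : ∀ j, ‖powSeries (P.coeff j) (lam * ((x - P.a : ℝ) : ℂ) ^ 2)‖ ≤ B j :=
    fun j => (P.isEntireCoeff_coeff j).norm_powSeries_le hz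
  have hmain : ‖P.C i x lam * P.C j x lam‖ ≤ E i j * Q i j * (B i * B j) * |x - P.a| ^ P.κ := by
    rw [C_eq, C_eq, mul_mul_mul_comm, ← Complex.cpow_add _ _ hx'', norm_mul]
    have h1 := norm_cpow_ofReal_le (x - P.a) hx' (P.μ i + P.μ j)
    have h3 : ‖powSeries (P.coeff i) (lam * ((x - P.a : ℝ) : ℂ) ^ 2) *
        powSeries (P.coeff j) (lam * ((x - P.a : ℝ) : ℂ) ^ 2)‖ ≤ B i * B j := by
      rw [norm_mul]
      exact mul_le_mul (hb i) (hb j) (norm_nonneg _) (hB i)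
    calc _ ≤ (E i j * (Q i j * |x - P.a| ^ P.κ)) * (B i * B j) := by
          refine mul_le_mul (h1.trans ?_) h3 (norm_nonneg _) (by positivity)
          gcongr
      _ = _ := by ring
  refine hmain.trans ?_
  gcongr
  calc E i j * Q i j * (B i * B j) ≤ ∑ j, E i j * Q i j * (B i * B j) :=
        Finset.single_le_sum (f := fun j => E i j * Q i j * (B i * B j))
          (fun j _ => hnn i j) (Finset.mem_univ j)
    _ ≤ _ := Finset.single_le_sum (f := fun i => ∑ j, E i j * Q i j * (B i * B j))
          (fun i _ => Finset.sum_nonneg fun j _ => hnn i j) (Finset.mem_univ i)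

end SLProblem

/-! ### Variation of constants through the singular point. -/

theorem IsPrimitiveOn.congr_ae {𝕜 : Type*} [RCLike 𝕜] {I : Set ℝ} [hI : I.OrdConnected]
    {F f g : ℝ → 𝕜} (hF : IsPrimitiveOn I F f) (hg : ∀ᵐ x, x ∈ I → g x = f x) :
    IsPrimitiveOn I F g := by
  intro x hx y hy
  have h : ∀ᵐ t, t ∈ uIoc x y → f t = g t := hg.mono fun t ht hxy =>
    (ht (hI.uIcc_subset hx hy (uIoc_subset_uIcc hxy))).symm
  refine ⟨(hF hx hy).1.congr_ae ((ae_restrict_iff' measurableSet_uIoc).2 h), ?_⟩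
  rw [(hF hx hy).2]
  exact intervalIntegral.integral_congr_ae h

theorem ae_ne_point (a : ℝ) : ∀ᵐ x : ℝ, x ≠ a := by
  simp [ae_iff, measure_singleton]

/-- The moments of a nonnegative density against the powers of its primitive. -/
theorem setIntegral_mul_pow_primitive {I : Set ℝ} [I.OrdConnected] {a : ℝ} (ha : a ∈ I)
    {w : ℝ → ℝ} (hw : ∀ x, 0 ≤ w x) (hi : ∀ x ∈ I, IntervalIntegrable w volume a x) (n : ℕ)
    {x : ℝ} (hx : x ∈ I) :
    ∫ t in uIoc a x, w t * |∫ s in a..t, w s| ^ n =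
      |∫ s in a..x, w s| ^ (n + 1) / (n + 1) := by
  have hn : (n + 1 : ℝ) ≠ 0 := by positivity
  rcases le_total a x with h | h
  · have hP : IsPrimitiveOn I (fun t => ∫ s in a..t, w s) w :=
      IsPrimitiveOn.of_integral (c := a) fun y hy => ⟨hi y hy, by simp⟩
    have hpos : ∀ t, a ≤ t → |∫ s in a..t, w s| = ∫ s in a..t, w s := fun t ht =>
      abs_of_nonneg (intervalIntegral.integral_nonneg ht fun s _ => hw s)
    have := ((hP.pow n) ha hx).2
    beta_reduce at this
    rw [intervalIntegral.integral_const_mul, intervalIntegral.integral_same] at this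
    rw [hpos x h, uIoc_of_le h, setIntegral_congr_fun (g := fun t => w t * (∫ s in a..t, w s) ^ n)
      measurableSet_Ioc fun t ht => by simp only [hpos t ht.1.le],
      ← intervalIntegral.integral_of_le h, eq_div_iff hn]
    rw [zero_pow (by omega), sub_zero] at this
    linarith
  · have hP : IsPrimitiveOn I (fun t => -∫ s in a..t, w s) fun t => -w t :=
      IsPrimitiveOn.of_integral (c := a) fun y hy => ⟨(hi y hy).neg, by simp⟩
    have hpos : ∀ t, t ≤ a → |∫ s in a..t, w s| = -∫ s in a..t, w s := fun t ht => by
      rw [intervalIntegral.integral_symm, abs_neg, neg_neg]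
      exact abs_of_nonneg (intervalIntegral.integral_nonneg ht fun s _ => hw s)
    have := ((hP.pow n) ha hx).2
    beta_reduce at this
    rw [intervalIntegral.integral_const_mul, intervalIntegral.integral_same] at this
    rw [hpos x h, uIoc_of_ge h, setIntegral_congr_fun
      (g := fun t => -(-w t * (-∫ s in a..t, w s) ^ n))
      measurableSet_Ioc fun t ht => by simp only [hpos t ht.2]; ring,
      ← intervalIntegral.integral_of_le h, intervalIntegral.integral_neg,
      ← intervalIntegral.integral_symm, eq_div_iff hn]
    rw [neg_zero, zero_pow (by omega), sub_zero] at this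
    linarith

namespace SLProblem

variable {P : SLProblem}

theorem continuousOn_C (P : SLProblem) (j : Fin 2) (lam : ℂ) :
    ContinuousOn (fun x => P.C j x lam) {P.a}ᶜ :=
  fun _ hx => (hasDerivAt_C j hx lam).continuousAt.continuousWithinAt

theorem Admissible.continuousOn_dC (h : P.Admissible) (j : Fin 2) (lam : ℂ) :
    ContinuousOn (fun x => P.dC j x lam) {P.a}ᶜ :=
  fun _ hx => (h.hasDerivAt_dC j hx lam).continuousAt.continuousWithinAt

/-- Beyond T the weight is at most (T-a)^κ because κ ≤ 0, so the two integrability conditions merge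
into one. On (0,T) measurability of q is recovered by dividing by the weight. -/
theorem Admissible.integrableOn_weight (h : P.Admissible) :
    AEStronglyMeasurable P.q (volume.restrict (Ioi 0)) ∧
      IntegrableOn (fun x => ‖P.q x‖ * |x - P.a| ^ P.κ) (Ioi 0) := by
  obtain ⟨T, hT, h1, h2⟩ := h.potential
  have hT0 : 0 < T := h.a_pos.trans hT
  have hU : Ioi (0 : ℝ) = Ioo 0 T ∪ Ici T := (Ioo_union_Ici_eq_Ioi hT0).symm
  have h2' : IntegrableOn P.q (Ici T) := (integrableOn_Ici_iff_integrableOn_Ioi).2 h2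
  have hq : AEStronglyMeasurable P.q (volume.restrict (Ioi 0)) := by
    rw [hU, aestronglyMeasurable_union_iff]
    refine ⟨?_, h2'.1⟩
    have hw : AEStronglyMeasurable (fun x : ℝ => ((|x - P.a| ^ P.κ : ℝ) : ℂ)⁻¹)
        (volume.restrict (Ioo 0 T)) := by
      refine Measurable.aestronglyMeasurable ?_
      fun_prop
    refine (h1.1.mul hw).congr ?_
    filter_upwards [ae_restrict_of_ae (ae_ne_point P.a)] with x hx
    have : ((|x - P.a| ^ P.κ : ℝ) : ℂ) ≠ 0 := by
      exact_mod_cast (Real.rpow_pos_of_pos (abs_pos.2 (sub_ne_zero.2 hx)) _).ne'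
    change P.q x * ((|x - P.a| ^ P.κ : ℝ) : ℂ) * ((|x - P.a| ^ P.κ : ℝ) : ℂ)⁻¹ = P.q x
    rw [mul_inv_cancel_right₀ this]
  refine ⟨hq, ?_⟩
  rw [hU]
  refine IntegrableOn.union ?_ ?_
  · refine h1.norm.congr (Eventually.of_forall fun x => ?_)
    change ‖P.q x * ((|x - P.a| ^ P.κ : ℝ) : ℂ)‖ = _
    rw [norm_mul, Complex.norm_real, Real.norm_of_nonneg (by positivity)]
  · refine Integrable.mono' (h2'.norm.mul_const ((T - P.a) ^ P.κ)) ?_ ?_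
    · exact h2'.1.norm.mul (Measurable.aestronglyMeasurable (by fun_prop))
    · refine (ae_restrict_iff' measurableSet_Ici).2 (Eventually.of_forall fun x hx => ?_)
      have hx' : T ≤ x := hx
      rw [Real.norm_of_nonneg (by positivity), abs_of_pos (by linarith)]
      gcongr ?_ * ?_
      exact Real.rpow_le_rpow_of_nonpos (by linarith) (by linarith) (min_le_left _ _)

/-- The row vector `(-C₂, C₁)`. -/
def row (P : SLProblem) (i : Fin 2) (t : ℝ) (lam : ℂ) : ℂ := ![-P.C 1 t lam, P.C 0 t lam] i

/-- The matrix of the system obtained by variation of constants. -/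
def ampMatrix (P : SLProblem) (lam : ℂ) (t : ℝ) (i j : Fin 2) : ℂ :=
  P.row i t lam * P.C j t lam * P.q t

/-- `α` solves on `I` the system obtained by variation of constants. -/
def IsAmplitude (P : SLProblem) (I : Set ℝ) (lam : ℂ) (α : ℝ → Fin 2 → ℂ) : Prop :=
  ∀ i, IsPrimitiveOn I (fun x => α x i) fun t => ∑ j, P.ampMatrix lam t i j * α t j

/-- Liouville's formula: the matrix has trace (-C₂C₁ + C₁C₂)q = 0. -/
theorem IsAmplitude.det_eq {I : Set ℝ} [I.OrdConnected] {lam : ℂ} {α β : ℝ → Fin 2 → ℂ}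
    (hα : P.IsAmplitude I lam α) (hβ : P.IsAmplitude I lam β) {x y : ℝ} (hx : x ∈ I) (hy : y ∈ I) :
    α x 0 * β x 1 - α x 1 * β x 0 = α y 0 * β y 1 - α y 1 * β y 0 := by
  refine (((hα 0).mul (hβ 1)).sub ((hα 1).mul (hβ 0))).eq_of_forall_zero (fun t _ => ?_) hx hy
  simp only [Fin.sum_univ_two, ampMatrix, row, Matrix.cons_val_zero, Matrix.cons_val_one]
  ring

theorem Admissible.exists_norm_ampMatrix_le (h : P.Admissible) (R r : ℝ) :
    ∃ K, 0 ≤ K ∧ ∀ lam : ℂ, ‖lam‖ ≤ r → ∀ x, x ≠ P.a → |x - P.a| ≤ R → ∀ i j : Fin 2,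
      ‖P.ampMatrix lam x i j‖ ≤ K * (‖P.q x‖ * |x - P.a| ^ P.κ) := by
  obtain ⟨K, hK, hb⟩ := h.exists_norm_C_mul_C_le R r
  refine ⟨K, hK, fun lam hl x hx hxR i j => ?_⟩
  rw [ampMatrix, norm_mul]
  have : ‖P.row i x lam * P.C j x lam‖ ≤ K * |x - P.a| ^ P.κ := by
    fin_cases i
    · simpa [row] using hb lam hl x hx hxR 1 j
    · simpa [row] using hb lam hl x hx hxR 0 j
  calc _ ≤ K * |x - P.a| ^ P.κ * ‖P.q x‖ := by gcongr
    _ = _ := by ring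

theorem Admissible.aestronglyMeasurable_ampMatrix (h : P.Admissible) (lam : ℂ) (i j : Fin 2) :
    AEStronglyMeasurable (fun t => P.ampMatrix lam t i j) (volume.restrict (Ioi 0 \ {P.a})) := by
  have hC : ∀ j, AEStronglyMeasurable (fun t => P.C j t lam) (volume.restrict (Ioi 0 \ {P.a})) :=
    fun j => ((P.continuousOn_C j lam).mono fun t ht => ht.2).aestronglyMeasurable
      (measurableSet_Ioi.diff (measurableSet_singleton _))
  have hrow : AEStronglyMeasurable (fun t => P.row i t lam)
      (volume.restrict (Ioi 0 \ {P.a})) := by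
    fin_cases i
    · exact (hC 1).neg
    · exact hC 0
  exact (hrow.mul (hC j)).mul (h.integrableOn_weight.1.mono_set sdiff_subset)

theorem restrict_diff_singleton (s : Set ℝ) (a : ℝ) :
    volume.restrict (s \ {a}) = volume.restrict s :=
  Measure.restrict_congr_set (sdiff_null_ae_eq_self (measure_singleton a))

theorem uIoc_subset_Ioi {a x : ℝ} (ha : 0 < a) (hx : 0 ≤ x) : uIoc a x ⊆ Ioi 0 := by
  intro t ht
  exact lt_of_le_of_lt (le_min ha.le hx) ht.1

theorem Admissible.intervalIntegrable_ampMatrix_mul (h : P.Admissible) (lam : ℂ) {R : ℝ}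
    (hR : P.a ≤ R) {g : ℝ → ℂ} (hg : ContinuousOn g (Icc 0 R)) {x : ℝ} (hx : x ∈ Icc 0 R)
    (i j : Fin 2) :
    IntervalIntegrable (fun t => P.ampMatrix lam t i j * g t) volume P.a x := by
  have ha : P.a ∈ Icc 0 R := ⟨h.a_pos.le, hR⟩
  have hsub : uIcc P.a x ⊆ Icc 0 R := ordConnected_Icc.uIcc_subset ha hx
  refine IntervalIntegrable.mul_continuousOn ?_ (hg.mono hsub)
  rw [intervalIntegrable_iff, IntegrableOn, ← restrict_diff_singleton _ P.a]
  obtain ⟨K, hK, hb⟩ := h.exists_norm_ampMatrix_le R ‖lam‖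
  have hsub' := uIoc_subset_Ioi h.a_pos hx.1
  refine Integrable.mono' (g := fun t => K * (‖P.q t‖ * |t - P.a| ^ P.κ)) ?_
    ((h.aestronglyMeasurable_ampMatrix lam i j).mono_set (sdiff_subset_sdiff_left hsub')) ?_
  · exact (h.integrableOn_weight.2.mono_set (sdiff_subset.trans hsub')).const_mul K
  · refine (ae_restrict_iff' (measurableSet_uIoc.diff (measurableSet_singleton _))).2
      (Eventually.of_forall fun t ht => hb lam le_rfl t ht.2 ?_ i j)
    have := hsub (uIoc_subset_uIcc ht.1)
    rw [abs_le]
    constructor <;> linarith [this.1, this.2, h.a_pos]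

theorem Admissible.exists_amplitude (h : P.Admissible) {R : ℝ} (hR : P.a ≤ R) (r : ℝ)
    (e : Fin 2 → ℂ) :
    ∃ f : ℂ → ℝ → Fin 2 → ℂ, (∀ lam ∈ Metric.ball (0 : ℂ) r, f lam P.a = e ∧
        P.IsAmplitude (Icc 0 R) lam (f lam)) ∧
      ∀ x ∈ Icc 0 R, ∀ i, HolCont (Metric.ball 0 r) fun lam => f lam x i := by
  have ha : P.a ∈ Icc 0 R := ⟨h.a_pos.le, hR⟩
  obtain ⟨K, hK, hb⟩ := h.exists_norm_ampMatrix_le R r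
  set w : ℝ → ℝ := fun t => ‖P.q t‖ * |t - P.a| ^ P.κ with hw
  have hw0 : ∀ t, 0 ≤ w t := fun t => by positivity
  have hwi : ∀ x ∈ Icc 0 R, IntervalIntegrable w volume P.a x := fun x hx => by
    rw [intervalIntegrable_iff]
    exact h.integrableOn_weight.2.mono_set (uIoc_subset_Ioi h.a_pos hx.1)
  -- The point a is removed because the kernel bound excludes it; the sign in `k` turns the integral
  -- over an unordered interval into the oriented one.
  let J : ℝ → Set ℝ := fun x => uIoc P.a x \ {P.a}
  let k : ℂ → ℝ → ℝ → Fin 2 → Fin 2 → ℂ := fun lam x t i j =>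
    (if P.a ≤ x then 1 else -1) * P.ampMatrix lam t i j
  have hJ : ∀ x ∈ Icc 0 R, J x ⊆ Icc 0 R := fun x hx =>
    sdiff_subset.trans (uIoc_subset_uIcc.trans (ordConnected_Icc.uIcc_subset ha hx))
  have hsign : ∀ x : ℝ, ‖(if P.a ≤ x then 1 else -1 : ℂ)‖ = 1 := fun x => by split_ifs <;> simp
  have hint : ∀ lam (x : ℝ) (g : ℝ → Fin 2 → ℂ) i,
      ∫ t in J x, ∑ j, k lam x t i j * g t j =
        ∫ t in P.a..x, ∑ j, P.ampMatrix lam t i j * g t j := by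
    intro lam x g i
    rw [restrict_diff_singleton, intervalIntegral.intervalIntegral_eq_integral_uIoc,
      ← integral_smul]
    refine integral_congr_ae (Eventually.of_forall fun t => ?_)
    simp only [k, mul_assoc, ← Finset.mul_sum]
    split_ifs
    · simp
    · simp; ring
  have hGm : IsPrimitiveOn (Icc 0 R) (fun x => ∫ s in P.a..x, w s) w :=
    IsPrimitiveOn.of_integral (c := P.a) fun y hy => ⟨hwi y hy, by simp⟩
  have hprim : ∀ (lam : ℂ) (g : ℝ → Fin 2 → ℂ) (c : ℂ) i,
      (∀ j, ContinuousOn (fun t => g t j) (Icc 0 R)) →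
      IsPrimitiveOn (Icc 0 R) (fun x => c + ∫ t in P.a..x, ∑ j, P.ampMatrix lam t i j * g t j)
        fun t => ∑ j, P.ampMatrix lam t i j * g t j := by
    intro lam g c i hg
    refine IsPrimitiveOn.of_integral (c := P.a) fun y hy => ⟨?_, by simp⟩
    simp only [Fin.sum_univ_two]
    exact (h.intervalIntegrable_ampMatrix_mul lam hR (hg 0) hy i 0).add
      (h.intervalIntegrable_ampMatrix_mul lam hR (hg 1) hy i 1)
  -- The n-th iterate is bounded by (2K|∫_a^x w|)^n/n! times the sum of the |e_i|; the 2 counts the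
  -- components.
  obtain ⟨f, hfc, -, hfh, hfe⟩ := exists_volterra_solution (ι := Fin 2) (S := Metric.ball 0 r)
    (I := Icc 0 R) (J := J) hJ
    (fun x => measurableSet_uIoc.diff (measurableSet_singleton _)) (k := k)
    (m := fun t => K * w t) (b := fun n x => (2 * K * |∫ s in P.a..x, w s|) ^ n / n.factorial *
      ∑ i, ‖e i‖)
    (β := fun n => (2 * K * ∫ s in Ioi 0, w s) ^ n / n.factorial * ∑ i, ‖e i‖)
    (f₀ := fun _ _ => e)
    (fun lam _ x hx i j => ((h.aestronglyMeasurable_ampMatrix lam i j).mono_set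
      (sdiff_subset_sdiff_left (uIoc_subset_Ioi h.a_pos hx.1))).const_mul _)
    (fun lam hl x hx t ht i j => by
      rw [norm_mul, hsign, one_mul]
      refine hb lam (mem_ball_zero_iff.1 hl).le t ht.2 ?_ i j
      have := hJ x hx ht
      rw [abs_le]
      constructor <;> linarith [this.1, this.2, h.a_pos])
    (fun x _ t _ i j => by
      refine (HolCont.const _).mul ((HolCont.mul ?_ ?_).mul (HolCont.const _))
      · fin_cases i
        · exact HolCont.of_differentiable (differentiable_C 1 t).neg
        · exact HolCont.of_differentiable (differentiable_C 0 t)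
      · exact HolCont.of_differentiable (differentiable_C j t))
    (fun x hx => (h.integrableOn_weight.2.mono_set
      (sdiff_subset.trans (uIoc_subset_Ioi h.a_pos hx.1))).const_mul K)
    (fun lam _ g _ hg _ i => by
      simp only [hint]
      simpa using (hprim lam g 0 i hg).continuousOn)
    (fun n => by
      refine (((continuousOn_const.mul hGm.continuousOn.abs).pow n).div_const _).mul_const _)
    (fun n x hx => by
      refine le_of_eq ?_
      have := setIntegral_mul_pow_primitive ha hw0 hwi n hx
      have hn : (n + 1 : ℝ) ≠ 0 := by positivity
      have hn' : (n.factorial : ℝ) ≠ 0 := by positivity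
      rw [restrict_diff_singleton, integral_congr_ae (g := fun t =>
        K * (2 * K) ^ n / n.factorial * (∑ i, ‖e i‖) * (w t * |∫ s in P.a..t, w s| ^ n))
        (Eventually.of_forall fun t => by simp only [mul_pow]; ring), integral_const_mul, this,
        Nat.factorial_succ]
      push_cast
      simp only [Fintype.card_fin, mul_pow]
      push_cast
      field_simp
      ring)
    (fun n x hx => by
      refine mul_le_mul_of_nonneg_right ?_ (Finset.sum_nonneg fun i _ => norm_nonneg _)
      gcongr
      rw [intervalIntegral.abs_intervalIntegral_eq, abs_of_nonneg (integral_nonneg hw0)]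
      exact setIntegral_mono_set h.integrableOn_weight.2 (Eventually.of_forall hw0)
        (uIoc_subset_Ioi h.a_pos hx.1).eventuallyLE)
    ((Real.summable_pow_div_factorial _).mul_right _)
    (fun _ _ _ => continuousOn_const) (fun _ _ _ => HolCont.const _)
    (fun _ _ _ _ i => by
      simp only [pow_zero, Nat.factorial_zero, Nat.cast_one, div_one, one_mul]
      exact Finset.single_le_sum (f := fun i => ‖e i‖) (fun i _ => norm_nonneg _)
        (Finset.mem_univ i))
  have hfe' : ∀ lam ∈ Metric.ball (0 : ℂ) r, ∀ x ∈ Icc 0 R, ∀ i,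
      f lam x i = e i + ∫ t in P.a..x, ∑ j, P.ampMatrix lam t i j * f lam t j :=
    fun lam hl x hx i => by rw [hfe lam hl x hx i, hint]
  refine ⟨f, fun lam hl => ⟨?_, fun i => ?_⟩, hfh⟩
  · ext i
    rw [hfe' lam hl P.a ha i]
    simp
  · exact (hprim lam (f lam) (e i) i (hfc lam hl)).congr (fun x hx => hfe' lam hl x hx i)
      fun _ _ => rfl

/-- The determinants of a solution with the solutions taking the values (1,0) and (0,1) at a are
constant, hence fixed by its value at a. The latter two have determinant 1, so Cramer's rule
recovers the solution. -/
theorem Admissible.amplitude_unique (h : P.Admissible) {R : ℝ} (hR : P.a ≤ R) {lam : ℂ}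
    {α β : ℝ → Fin 2 → ℂ} (hα : P.IsAmplitude (Icc 0 R) lam α)
    (hβ : P.IsAmplitude (Icc 0 R) lam β) (hαβ : α P.a = β P.a) {x : ℝ} (hx : x ∈ Icc 0 R) :
    α x = β x := by
  have ha : P.a ∈ Icc 0 R := ⟨h.a_pos.le, hR⟩
  obtain ⟨f, hf, -⟩ := h.exists_amplitude hR (‖lam‖ + 1) ![1, 0]
  obtain ⟨g, hg, -⟩ := h.exists_amplitude hR (‖lam‖ + 1) ![0, 1]
  have hl : lam ∈ Metric.ball (0 : ℂ) (‖lam‖ + 1) := by simp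
  obtain ⟨hfa, hfA⟩ := hf lam hl
  obtain ⟨hga, hgA⟩ := hg lam hl
  have h1 := hfA.det_eq hgA hx ha
  have h2 := hα.det_eq hgA hx ha
  have h3 := hα.det_eq hfA hx ha
  have h4 := hβ.det_eq hgA hx ha
  have h5 := hβ.det_eq hfA hx ha
  simp only [hfa, hga, hαβ, Matrix.cons_val_zero, Matrix.cons_val_one] at h1 h2 h3 h4 h5
  ext i
  fin_cases i
  · simp only [Fin.zero_eta]
    linear_combination (β x 0 - α x 0) * h1 + f lam x 0 * (h2 - h4) - g lam x 0 * (h3 - h5)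
  · simp only [Fin.mk_one]
    linear_combination (β x 1 - α x 1) * h1 + f lam x 1 * (h2 - h4) - g lam x 1 * (h3 - h5)

open Classical in
/-- The amplitude vector with value `e_j` at the singular point. -/
def amp (P : SLProblem) (j : Fin 2) (lam : ℂ) (x : ℝ) : Fin 2 → ℂ :=
  if h : P.Admissible ∧ 0 ≤ x then
    (h.1.exists_amplitude (R := P.a + x) (by linarith [h.2]) (‖lam‖ + 1) (Pi.single j 1)).choose
      lam x
  else 0

/-- `amp` chooses a solution afresh for each x and λ; uniqueness makes these choices coherent, so
its properties can be read off from any single solution on a longer interval or over a disc of λ. -/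
theorem Admissible.amp_eq (h : P.Admissible) {R : ℝ} (hR : P.a ≤ R) {j : Fin 2} {lam : ℂ}
    {α : ℝ → Fin 2 → ℂ} (hαa : α P.a = Pi.single j 1) (hα : P.IsAmplitude (Icc 0 R) lam α) {x : ℝ}
    (hx : x ∈ Icc 0 R) : P.amp j lam x = α x := by
  have h0 : P.Admissible ∧ 0 ≤ x := ⟨h, hx.1⟩
  rw [amp, dif_pos h0]
  have hs := (h0.1.exists_amplitude (R := P.a + x) (by linarith [h0.2]) (‖lam‖ + 1)
    (Pi.single j 1)).choose_spec.1 lam (by simp)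
  refine h.amplitude_unique (R := min R (P.a + x)) (le_min hR (by linarith [hx.1]))
    (fun i => (hs.2 i).mono (Icc_subset_Icc_right (min_le_right _ _)))
    (fun i => (hα i).mono (Icc_subset_Icc_right (min_le_left _ _)))
    (hs.1.trans hαa.symm) ⟨hx.1, le_min hx.2 (by linarith [h.a_pos])⟩

theorem row_zero (t : ℝ) (lam : ℂ) : P.row 0 t lam = -P.C 1 t lam := rfl

theorem row_one (t : ℝ) (lam : ℂ) : P.row 1 t lam = P.C 0 t lam := rfl

theorem Admissible.amp_apply_a (h : P.Admissible) (j : Fin 2) (lam : ℂ) :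
    P.amp j lam P.a = Pi.single j 1 := by
  obtain ⟨f, hf, -⟩ := h.exists_amplitude (le_refl P.a) (‖lam‖ + 1) (Pi.single j 1)
  obtain ⟨hfa, hfA⟩ := hf lam (by simp)
  rw [h.amp_eq le_rfl hfa hfA ⟨h.a_pos.le, le_rfl⟩, hfa]

theorem Admissible.isAmplitude_amp (h : P.Admissible) (j : Fin 2) (lam : ℂ) :
    P.IsAmplitude (Ici 0) lam (P.amp j lam) := by
  intro i x hx y hy
  have hR : P.a ≤ max P.a (max x y) := le_max_left _ _
  obtain ⟨f, hf, -⟩ := h.exists_amplitude hR (‖lam‖ + 1) (Pi.single j 1)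
  obtain ⟨hfa, hfA⟩ := hf lam (by simp)
  refine ((hfA i).congr (G := fun x => P.amp j lam x i)
    (g := fun t => ∑ l, P.ampMatrix lam t i l * P.amp j lam t l) (fun t ht => ?_)
    fun t ht => ?_) ⟨hx, ?_⟩ ⟨hy, ?_⟩
  · rw [h.amp_eq hR hfa hfA ht]
  · rw [h.amp_eq hR hfa hfA ht]
  · exact (le_max_left _ _).trans (le_max_right _ _)
  · exact (le_max_right _ _).trans (le_max_right _ _)

theorem Admissible.differentiable_amp (h : P.Admissible) (j : Fin 2) {x : ℝ} (hx : 0 ≤ x)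
    (i : Fin 2) : Differentiable ℂ fun lam => P.amp j lam x i := by
  intro lam
  have hR : P.a ≤ max P.a x := le_max_left _ _
  have hxR : x ∈ Icc 0 (max P.a x) := ⟨hx, le_max_right _ _⟩
  obtain ⟨f, hf, hh⟩ := h.exists_amplitude hR (‖lam‖ + 1) (Pi.single j 1)
  have hl : Metric.ball (0 : ℂ) (‖lam‖ + 1) ∈ 𝓝 lam := Metric.isOpen_ball.mem_nhds (by simp)
  have hd := (hh x hxR i).2
  rw [Metric.isOpen_ball.interior_eq] at hd
  refine (hd.differentiableAt hl).congr_of_eventuallyEq ?_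
  filter_upwards [hl] with l hl
  obtain ⟨hfa, hfA⟩ := hf l hl
  rw [h.amp_eq hR hfa hfA hxR]

theorem Admissible.isIntegralSolution_amp (h : P.Admissible) (j : Fin 2) (lam : ℂ) :
    P.IsIntegralSolution j lam fun x => P.amp j lam x 0 * P.C 0 x lam +
      P.amp j lam x 1 * P.C 1 x lam := by
  have hA := h.isAmplitude_amp j lam
  have ha : P.a ∈ Ici (0 : ℝ) := h.a_pos.le
  have hdom : P.dom ⊆ Ici 0 := fun x hx => hx.1
  have hdom' : P.dom ⊆ {P.a}ᶜ := fun x hx => hx.2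
  refine ⟨?_, fun x hx => ?_⟩
  · exact (((hA 0).continuousOn.mono hdom).mul ((P.continuousOn_C 0 lam).mono hdom')).add
      (((hA 1).continuousOn.mono hdom).mul ((P.continuousOn_C 1 lam).mono hdom'))
  · have e0 : ∀ t, P.C 0 t lam * P.q t * (P.amp j lam t 0 * P.C 0 t lam +
        P.amp j lam t 1 * P.C 1 t lam) = ∑ l, P.ampMatrix lam t 1 l * P.amp j lam t l := by
      intro t
      simp only [Fin.sum_univ_two, ampMatrix, row_one]
      ring
    have e1 : ∀ t, P.C 1 t lam * P.q t * (P.amp j lam t 0 * P.C 0 t lam +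
        P.amp j lam t 1 * P.C 1 t lam) = -∑ l, P.ampMatrix lam t 0 l * P.amp j lam t l := by
      intro t
      simp only [Fin.sum_univ_two, ampMatrix, row_zero]
      ring
    obtain ⟨i0, h0⟩ := hA 0 ha (hdom hx)
    obtain ⟨i1, h1⟩ := hA 1 ha (hdom hx)
    refine ⟨fun i => ?_, ?_⟩
    · fin_cases i
      · simp only [Fin.zero_eta, e0]; exact i1
      · simp only [Fin.mk_one, e1]; exact i0.neg
    · have e2 : ∀ t, P.g x t lam * P.q t * (P.amp j lam t 0 * P.C 0 t lam +
          P.amp j lam t 1 * P.C 1 t lam) =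
          P.C 1 x lam * (∑ l, P.ampMatrix lam t 1 l * P.amp j lam t l) +
          P.C 0 x lam * ∑ l, P.ampMatrix lam t 0 l * P.amp j lam t l := by
        intro t
        rw [← e0, ← neg_neg (∑ l, P.ampMatrix lam t 0 l * P.amp j lam t l), ← e1, g]
        ring
      simp only [e2]
      rw [intervalIntegral.integral_add (i1.const_mul _) (i0.const_mul _),
        intervalIntegral.integral_const_mul, intervalIntegral.integral_const_mul, ← h0, ← h1]
      beta_reduce
      rw [h.amp_apply_a]
      fin_cases j <;> simp <;> ring

/-- Any integral solution f yields the amplitude e_j + ∫_a^x (-C₂, C₁) q f, to which uniqueness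
applies. Near a, only the absolute convergence of these integrals is used. -/
theorem Admissible.s_eq (h : P.Admissible) (j : Fin 2) (lam : ℂ) {x : ℝ} (hx : x ∈ P.dom) :
    P.s j x lam = P.amp j lam x 0 * P.C 0 x lam + P.amp j lam x 1 * P.C 1 x lam := by
  have hex : ∃ f : ℝ → ℂ, P.IsIntegralSolution j lam f := ⟨_, h.isIntegralSolution_amp j lam⟩
  rw [s, dif_pos hex]
  obtain ⟨-, hs⟩ := hex.choose_spec
  set f := hex.choose
  let u : ℝ → Fin 2 → ℂ := fun x i =>
    (Pi.single j 1 : Fin 2 → ℂ) i + ∫ t in P.a..x, P.row i t lam * P.q t * f t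
  have hrow : ∀ x ∈ Ici (0 : ℝ), ∀ i,
      IntervalIntegrable (fun t => P.row i t lam * P.q t * f t) volume P.a x := by
    intro x hx i
    rcases eq_or_ne x P.a with rfl | hxa
    · exact IntervalIntegrable.refl
    · fin_cases i
      · have := ((hs x ⟨hx, hxa⟩).1 1).neg
        refine this.congr fun t _ => ?_
        simp [row]
      · exact (hs x ⟨hx, hxa⟩).1 0
  have hfu : ∀ x ∈ P.dom, f x = u x 0 * P.C 0 x lam + u x 1 * P.C 1 x lam := by
    intro x hx
    have e : ∀ t, P.g x t lam * P.q t * f t = P.C 0 x lam * (P.row 0 t lam * P.q t * f t) +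
        P.C 1 x lam * (P.row 1 t lam * P.q t * f t) := by
      intro t
      simp only [g, row_zero, row_one]
      ring
    rw [(hs x hx).2]
    simp only [e]
    rw [intervalIntegral.integral_add ((hrow x hx.1 0).const_mul _) ((hrow x hx.1 1).const_mul _),
      intervalIntegral.integral_const_mul, intervalIntegral.integral_const_mul]
    simp only [u]
    fin_cases j <;> simp <;> ring
  have hu : P.IsAmplitude (Ici 0) lam u := by
    intro i
    have hp : IsPrimitiveOn (Ici 0) (fun x => u x i) fun t => P.row i t lam * P.q t * f t :=
      IsPrimitiveOn.of_integral (c := P.a) fun y hy => ⟨hrow y hy i, by simp [u]⟩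
    refine hp.congr_ae ?_
    filter_upwards [ae_ne_point P.a] with t hta ht
    rw [hfu t ⟨ht, hta⟩]
    simp only [Fin.sum_univ_two, ampMatrix]
    ring
  have hR : P.a ≤ max P.a x := le_max_left _ _
  change f x = _
  rw [hfu x hx, h.amp_eq hR (α := u) (by ext i; simp [u])
    (fun i => (hu i).mono Icc_subset_Ici_self) ⟨hx.1, le_max_right _ _⟩]

/-! ### The differential equation and the Wronskian of the s_j. -/

/-- The derivative of `s_j(x, λ)` with respect to `x`. -/
def ds (P : SLProblem) (j : Fin 2) (x : ℝ) (lam : ℂ) : ℂ :=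
  P.amp j lam x 0 * P.dC 0 x lam + P.amp j lam x 1 * P.dC 1 x lam

/-- `y` is a solution on `I` of the differential equation with derivative `dy`. -/
def IsSolutionOn (P : SLProblem) (I : Set ℝ) (lam : ℂ) (y dy : ℝ → ℂ) : Prop :=
  IsPrimitiveOn I y dy ∧ IsPrimitiveOn I dy fun x => (P.V x - lam) * y x

namespace IsSolutionOn

variable {I : Set ℝ} {lam : ℂ} {y dy z dz : ℝ → ℂ}

theorem wronskian_eq [I.OrdConnected] (hy : P.IsSolutionOn I lam y dy)
    (hz : P.IsSolutionOn I lam z dz) {s t : ℝ} (hs : s ∈ I) (ht : t ∈ I) :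
    y s * dz s - dy s * z s = y t * dz t - dy t * z t :=
  ((hy.1.mul hz.2).sub (hy.2.mul hz.1)).eq_of_forall_zero (fun u _ => by ring) hs ht

theorem linear_comb [I.OrdConnected] (hy : P.IsSolutionOn I lam y dy)
    (hz : P.IsSolutionOn I lam z dz) (b c : ℂ) :
    P.IsSolutionOn I lam (fun x => b * y x + c * z x) (fun x => b * dy x + c * dz x) :=
  ⟨(hy.1.const_mul b).add (hz.1.const_mul c),
    ((hy.2.const_mul b).add (hz.2.const_mul c)).congr (fun _ _ => rfl) fun _ _ => by ring⟩

theorem hasDerivWithinAt [I.OrdConnected] (hy : P.IsSolutionOn I lam y dy) {x : ℝ} (hx : x ∈ I) :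
    HasDerivWithinAt y (dy x) I x :=
  hy.1.hasDerivWithinAt hx (hy.2.continuousOn x hx)

end IsSolutionOn

/-- Since α₁'C₁ + α₂'C₂ = 0, only α₁C₁' + α₂C₂' remains in s'; in the second derivative α₁'C₁' +
α₂'C₂' equals q s because C₁, C₂ have Wronskian 1. -/
theorem Admissible.isSolutionOn_s (h : P.Admissible) {I : Set ℝ} [I.OrdConnected]
    (hI : I ⊆ P.dom) (j : Fin 2) (lam : ℂ) :
    P.IsSolutionOn I lam (fun x => P.s j x lam) fun x => P.ds j x lam := by
  have hI0 : I ⊆ Ici 0 := fun x hx => (hI hx).1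
  have hIa : I ⊆ {P.a}ᶜ := fun x hx => (hI hx).2
  have hC : ∀ i, IsPrimitiveOn I (fun x => P.C i x lam) fun x => P.dC i x lam := fun i =>
    IsPrimitiveOn.of_hasDerivAt (fun x hx => hasDerivAt_C i (hIa hx) lam)
      ((h.continuousOn_dC i lam).mono hIa)
  have hdC : ∀ i, IsPrimitiveOn I (fun x => P.dC i x lam)
      fun x => (P.ν₀ / ((x - P.a : ℝ) : ℂ) ^ 2 - lam) * P.C i x lam := fun i =>
    IsPrimitiveOn.of_hasDerivAt (fun x hx => h.hasDerivAt_dC i (hIa hx) lam) (by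
      refine ContinuousOn.mul (ContinuousOn.sub (ContinuousOn.div continuousOn_const
        (by fun_prop) fun x hx => ?_) continuousOn_const) ((P.continuousOn_C i lam).mono hIa)
      exact pow_ne_zero 2 (by exact_mod_cast sub_ne_zero.2 (hIa hx)))
  have hA := fun i => (h.isAmplitude_amp j lam i).mono hI0
  constructor
  · refine (((hA 0).mul (hC 0)).add ((hA 1).mul (hC 1))).congr
      (fun x hx => h.s_eq j lam (hI hx)) fun x _ => ?_
    simp only [Fin.sum_univ_two, ampMatrix, row_zero, row_one, ds]
    ring
  · refine (((hA 0).mul (hdC 0)).add ((hA 1).mul (hdC 1))).congr (fun x _ => rfl) fun x hx => ?_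
    beta_reduce
    rw [h.s_eq j lam (hI hx)]
    simp only [Fin.sum_univ_two, ampMatrix, row_zero, row_one, V]
    linear_combination (-P.q x * (P.amp j lam x 0 * P.C 0 x lam + P.amp j lam x 1 * P.C 1 x lam)) *
      h.wronskian_C (hIa hx) lam

theorem Admissible.wronskian_s (h : P.Admissible) (lam : ℂ) {x : ℝ} (hx : x ∈ P.dom) :
    P.s 0 x lam * P.ds 1 x lam - P.ds 0 x lam * P.s 1 x lam = 1 := by
  have h1 := (h.isAmplitude_amp 0 lam).det_eq (h.isAmplitude_amp 1 lam) (x := x) (y := P.a) hx.1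
    h.a_pos.le
  rw [h.amp_apply_a, h.amp_apply_a] at h1
  simp only [Pi.single_eq_same, ne_eq, zero_ne_one, one_ne_zero, not_false_eq_true,
    Pi.single_eq_of_ne] at h1
  rw [h.s_eq 0 lam hx, h.s_eq 1 lam hx, ds, ds]
  linear_combination h1 + (P.amp 0 lam x 0 * P.amp 1 lam x 1 - P.amp 0 lam x 1 * P.amp 1 lam x 0) *
    h.wronskian_C hx.2 lam

theorem Admissible.differentiable_s (h : P.Admissible) (j : Fin 2) {x : ℝ} (hx : x ∈ P.dom) :
    Differentiable ℂ fun lam => P.s j x lam := by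
  simp only [h.s_eq j _ hx]
  exact ((h.differentiable_amp j hx.1 0).mul (differentiable_C 0 x)).add
    ((h.differentiable_amp j hx.1 1).mul (differentiable_C 1 x))

theorem Admissible.differentiable_ds (h : P.Admissible) (j : Fin 2) {x : ℝ} (hx : x ∈ P.dom) :
    Differentiable ℂ fun lam => P.ds j x lam :=
  ((h.differentiable_amp j hx.1 0).mul (differentiable_dC 0 x)).add
    ((h.differentiable_amp j hx.1 1).mul (differentiable_dC 1 x))

end SLProblem

/-! ### The Jost solution near infinity. -/

theorem IsPrimitiveOn.setIntegral_Ioi {f : ℝ → ℂ} {R : ℝ} (hf : IntegrableOn f (Ioi R)) :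
    IsPrimitiveOn (Ici R) (fun x => ∫ t in Ioi x, f t) fun t => -f t := by
  intro x hx y hy
  have hx' : IntegrableOn f (Ioi x) := hf.mono_set (Ioi_subset_Ioi hx)
  have hy' : IntegrableOn f (Ioi y) := hf.mono_set (Ioi_subset_Ioi hy)
  constructor
  · refine IntervalIntegrable.neg ?_
    rw [intervalIntegrable_iff]
    refine hf.mono_set fun t ht => ?_
    exact lt_of_le_of_lt (le_min hx hy) ht.1
  · rw [intervalIntegral.integral_neg, ← intervalIntegral.integral_Ioi_sub_Ioi' hx' hy', neg_sub]

/-- The part `|ρ| > δ` of the closed upper half-plane. -/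
def upperOutside (δ : ℝ) : Set ℂ := {ρ | 0 ≤ ρ.im ∧ δ < ‖ρ‖}

theorem norm_exp_two_I_mul_le {ρ : ℂ} (hρ : 0 ≤ ρ.im) {t : ℝ} (ht : 0 ≤ t) :
    ‖Complex.exp (2 * Complex.I * ρ * t)‖ ≤ 1 := by
  rw [Complex.norm_exp, Real.exp_le_one_iff]
  have : (2 * Complex.I * ρ * t).re = -(2 * (ρ.im * t)) := by
    simp [Complex.mul_re, Complex.mul_im]
    ring
  rw [this]
  have := mul_nonneg hρ ht
  linarith

namespace SLProblem

variable {P : SLProblem}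

theorem Admissible.exists_integrableOn_V (h : P.Admissible) :
    ∃ T, P.a < T ∧ IntegrableOn P.V (Ioi T) := by
  obtain ⟨T, hT, -, h2⟩ := h.potential
  refine ⟨max T (P.a + 1), lt_max_of_lt_left hT, ?_⟩
  refine Integrable.add ?_ (h2.mono_set (Ioi_subset_Ioi (le_max_left _ _)))
  have h1 : Integrable fun x : ℝ => ‖P.ν₀‖ * (2 * (1 + (x - P.a) ^ 2)⁻¹) :=
    ((integrable_inv_one_add_sq.comp_sub_right P.a).const_mul 2).const_mul _
  refine Integrable.mono' h1.integrableOn (Measurable.aestronglyMeasurable (by fun_prop)) ?_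
  refine (ae_restrict_iff' measurableSet_Ioi).2 (Eventually.of_forall fun x hx => ?_)
  have hx1 : 1 ≤ x - P.a := by
    have := (le_max_right T (P.a + 1)).trans_lt hx
    linarith
  rw [norm_div, norm_pow, Complex.norm_real, Real.norm_eq_abs, sq_abs, div_eq_mul_inv]
  gcongr
  rw [← div_eq_mul_inv, inv_eq_one_div, div_le_div_iff₀ (by positivity) (by positivity)]
  nlinarith

theorem Admissible.exists_integral_V_le (h : P.Admissible) {ε : ℝ} (hε : 0 < ε) :
    ∃ R, P.a < R ∧ IntegrableOn P.V (Ioi R) ∧ ∫ t in Ioi R, ‖P.V t‖ ≤ ε := by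
  obtain ⟨T, hT, hV⟩ := h.exists_integrableOn_V
  have hlim : Tendsto (fun R : ℝ => ∫ t in Ioi R, ‖P.V t‖) atTop (𝓝 0) :=
    tendsto_integral_Ioi_zero tendsto_id
  obtain ⟨R, hR, hRT⟩ := ((hlim.eventually (Iic_mem_nhds hε)).and (eventually_ge_atTop T)).exists
  exact ⟨R, hT.trans_le hRT, hV.mono_set (Ioi_subset_Ioi hRT), hR⟩

/-- Decoupling x from t leaves tail integrals of integrands independent of x, which can be
differentiated in x. -/
theorem jostKernel_split {ρ : ℂ} {x : ℝ} {f : ℝ → ℂ} (hf : IntegrableOn f (Ioi x)) (hρ : ρ ≠ 0)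
    (hρ' : IntegrableOn (fun t : ℝ => Complex.exp (2 * Complex.I * ρ * t) * f t) (Ioi x)) :
    ∫ t in Ioi x, (Complex.exp (2 * Complex.I * ρ * (t - x : ℝ)) - 1) / (2 * Complex.I * ρ) * f t =
      1 / (2 * Complex.I * ρ) * (Complex.exp (-(2 * Complex.I * ρ * x)) *
        (∫ t in Ioi x, Complex.exp (2 * Complex.I * ρ * t) * f t) - ∫ t in Ioi x, f t) := by
  rw [← integral_const_mul, ← integral_sub (hρ'.const_mul _) hf, ← integral_const_mul]
  refine integral_congr_ae (Eventually.of_forall fun t => ?_)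
  have hI := Complex.I_ne_zero
  have : Complex.exp (2 * Complex.I * ρ * (t - x : ℝ)) =
      Complex.exp (-(2 * Complex.I * ρ * x)) * Complex.exp (2 * Complex.I * ρ * t) := by
    rw [← Complex.exp_add]
    congr 1
    push_cast
    ring
  simp only [this]
  field_simp

set_option maxHeartbeats 1000000 in
/-- Existence of the Jost solution near infinity. -/
theorem Admissible.exists_jost (h : P.Admissible) {δ : ℝ} (hδ : 0 < δ) :
    ∃ R, P.a < R ∧ ∃ e de : ℂ → ℝ → ℂ,
      (∀ ρ ∈ upperOutside δ, P.IsSolutionOn (Ici R) (ρ ^ 2) (e ρ) (de ρ) ∧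
        (∀ x ∈ Ici R, e ρ x ≠ 0) ∧
        Tendsto (fun x : ℝ => e ρ x * Complex.exp (-Complex.I * ρ * x)) atTop (𝓝 1)) ∧
      HolCont (upperOutside δ) (fun ρ => e ρ R) ∧ HolCont (upperOutside δ) fun ρ => de ρ R := by
  -- For |ρ| > δ the kernel is at most |V|/δ, so a tail of mass δ/4 makes the iteration geometric,
  -- and later keeps w within 1/2 of 1.
  obtain ⟨R, hR, hV, hVε⟩ := h.exists_integral_V_le (ε := δ / 4) (by positivity)
  have hVx : ∀ x ∈ Ici R, IntegrableOn P.V (Ioi x) := fun x hx =>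
    hV.mono_set (Ioi_subset_Ioi hx)
  have hVεx : ∀ x ∈ Ici R, ∫ t in Ioi x, ‖P.V t‖ ≤ δ / 4 := fun x hx =>
    (setIntegral_mono_set hV.norm (Eventually.of_forall fun t => norm_nonneg _)
      (Ioi_subset_Ioi hx).eventuallyLE).trans hVε
  have hne : ∀ ρ ∈ upperOutside δ, ρ ≠ 0 := by
    rintro ρ ⟨-, hρ⟩ rfl
    rw [norm_zero] at hρ
    linarith
  let S := upperOutside δ
  -- For e = e^{iρx}w the equation becomes w'' + 2iρw' = Vw; this is the kernel of its integral form
  -- with w → 1 at infinity.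
  let k : ℂ → ℝ → ℝ → Unit → Unit → ℂ := fun ρ x t _ _ =>
    (Complex.exp (2 * Complex.I * ρ * (t - x : ℝ)) - 1) / (2 * Complex.I * ρ) * P.V t
  have hkb : ∀ ρ ∈ S, ∀ x ∈ Ici R, ∀ t ∈ Ioi x, ∀ i j, ‖k ρ x t i j‖ ≤ ‖P.V t‖ / δ := by
    intro ρ hρ x _ t ht _ _
    have h1 : ‖Complex.exp (2 * Complex.I * ρ * (t - x : ℝ)) - 1‖ ≤ 2 := by
      refine (norm_sub_le _ _).trans ?_
      have := norm_exp_two_I_mul_le hρ.1 (t := t - x) (sub_nonneg.2 (le_of_lt ht))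
      rw [norm_one]
      linarith
    have h2 : ‖2 * Complex.I * ρ‖ = 2 * ‖ρ‖ := by simp
    have hρδ := hρ.2
    have hρ0 : 0 < ‖ρ‖ := hδ.trans hρδ
    simp only [k]
    rw [norm_mul, norm_div, h2, mul_comm, div_eq_mul_inv ‖P.V t‖]
    refine mul_le_mul_of_nonneg_left ?_ (norm_nonneg _)
    rw [div_le_iff₀ (by positivity), inv_mul_eq_div, le_div_iff₀ hδ]
    nlinarith
  have hexp : ∀ ρ : ℂ, ∀ g : ℝ → ℂ, ContinuousOn g (Ici R) → ∀ C, (∀ t ∈ Ici R, ‖g t‖ ≤ C) →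
      IntegrableOn (fun t => P.V t * g t) (Ioi R) := by
    intro ρ g hg C hC
    refine Integrable.mul_bdd (c := C) hV
      ((hg.mono Ioi_subset_Ici_self).aestronglyMeasurable measurableSet_Ioi)
      ((ae_restrict_iff' measurableSet_Ioi).2 (Eventually.of_forall fun t ht => hC t (Ioi_subset_Ici_self ht)))
  have hexp' : ∀ ρ ∈ S, ∀ g : ℝ → ℂ, ContinuousOn g (Ici R) → ∀ C, (∀ t ∈ Ici R, ‖g t‖ ≤ C) →
      IntegrableOn (fun t : ℝ => Complex.exp (2 * Complex.I * ρ * t) * (P.V t * g t)) (Ioi R) := by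
    intro ρ hρ g hg C hC
    refine Integrable.bdd_mul (c := ‖Complex.exp (2 * Complex.I * ρ * R)‖) (hexp ρ g hg C hC)
      (Continuous.aestronglyMeasurable (by fun_prop))
      ((ae_restrict_iff' measurableSet_Ioi).2 (Eventually.of_forall fun t ht => ?_))
    have : Complex.exp (2 * Complex.I * ρ * t) = Complex.exp (2 * Complex.I * ρ * R) *
        Complex.exp (2 * Complex.I * ρ * (t - R : ℝ)) := by
      rw [← Complex.exp_add]
      congr 1
      push_cast
      ring
    rw [this, norm_mul]
    exact mul_le_of_le_one_right (norm_nonneg _)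
      (norm_exp_two_I_mul_le hρ.1 (sub_nonneg.2 (le_of_lt ht)))
  have hker : ∀ ρ ∈ S, ∀ g : ℝ → ℂ, ContinuousOn g (Ici R) → ∀ C, (∀ t ∈ Ici R, ‖g t‖ ≤ C) →
      ∀ x ∈ Ici R, ∫ t in Ioi x, k ρ x t () () * g t = 1 / (2 * Complex.I * ρ) *
        (Complex.exp (-(2 * Complex.I * ρ * x)) *
        (∫ t in Ioi x, Complex.exp (2 * Complex.I * ρ * t) * (P.V t * g t)) -
          ∫ t in Ioi x, P.V t * g t) := by
    intro ρ hρ g hg C hC x hx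
    simp only [k, mul_assoc _ (P.V _)]
    exact jostKernel_split ((hexp ρ g hg C hC).mono_set (Ioi_subset_Ioi hx)) (hne ρ hρ)
      ((hexp' ρ hρ g hg C hC).mono_set (Ioi_subset_Ioi hx))
  have hexpd : ∀ ρ : ℂ, ∀ c : ℂ, IsPrimitiveOn (Ici R) (fun x : ℝ => Complex.exp (c * ρ * x))
      fun x : ℝ => c * ρ * Complex.exp (c * ρ * x) := by
    intro ρ c
    refine IsPrimitiveOn.of_hasDerivAt (fun x _ => ?_) (by fun_prop)
    have := ((Complex.ofRealCLM.hasDerivAt (x := x)).const_mul (c * ρ)).cexp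
    refine this.congr_deriv ?_
    simp [mul_comm]
  have hprim : ∀ ρ ∈ S, ∀ g : ℝ → ℂ, ContinuousOn g (Ici R) → ∀ C, (∀ t ∈ Ici R, ‖g t‖ ≤ C) →
      IsPrimitiveOn (Ici R) (fun x : ℝ => Complex.exp (-(2 * Complex.I) * ρ * x) *
        ∫ t in Ioi x, Complex.exp (2 * Complex.I * ρ * t) * (P.V t * g t))
        (fun x : ℝ => -(2 * Complex.I) * ρ * (Complex.exp (-(2 * Complex.I) * ρ * x) *
          ∫ t in Ioi x, Complex.exp (2 * Complex.I * ρ * t) * (P.V t * g t)) - P.V x * g x) := by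
    intro ρ hρ g hg C hC
    refine ((hexpd ρ (-(2 * Complex.I))).mul
      (IsPrimitiveOn.setIntegral_Ioi (hexp' ρ hρ g hg C hC))).congr (fun _ _ => rfl) fun x _ => ?_
    have : Complex.exp (-(2 * Complex.I) * ρ * x) * Complex.exp (2 * Complex.I * ρ * x) = 1 := by
      rw [← Complex.exp_add, show -(2 * Complex.I) * ρ * x + 2 * Complex.I * ρ * x = 0 by ring,
        Complex.exp_zero]
    linear_combination (P.V x * g x) * this
  -- The kernel vanishes at t = x, so the boundary terms cancel and a single tail integral remains.
  have hprimw : ∀ ρ ∈ S, ∀ g : ℝ → ℂ, ContinuousOn g (Ici R) → ∀ C, (∀ t ∈ Ici R, ‖g t‖ ≤ C) →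
      IsPrimitiveOn (Ici R) (fun x : ℝ => ∫ t in Ioi x, k ρ x t () () * g t)
        (fun x : ℝ => -(Complex.exp (-(2 * Complex.I) * ρ * x) *
          ∫ t in Ioi x, Complex.exp (2 * Complex.I * ρ * t) * (P.V t * g t))) := by
    intro ρ hρ g hg C hC
    refine (((hprim ρ hρ g hg C hC).sub (IsPrimitiveOn.setIntegral_Ioi
      (hexp ρ g hg C hC))).const_mul (1 / (2 * Complex.I * ρ))).congr (fun x hx => ?_) fun x _ => ?_
    · rw [hker ρ hρ g hg C hC x hx]
      simp only [neg_mul]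
    · have := hne ρ hρ
      have := Complex.I_ne_zero
      field_simp
      ring
  obtain ⟨w, hwc, hwb, hwh, hwe⟩ := exists_volterra_solution (ι := Unit) (S := S) (I := Ici R)
    (J := fun x => Ioi x) (fun x hx => (Ioi_subset_Ioi hx).trans Ioi_subset_Ici_self)
    (fun x => measurableSet_Ioi) (k := k) (m := fun t => ‖P.V t‖ / δ)
    (b := fun n _ => (1 / 2) ^ n) (β := fun n => (1 / 2) ^ n) (f₀ := fun _ _ _ => 1)
    (fun ρ _ x hx _ _ => AEStronglyMeasurable.mul
      (Continuous.aestronglyMeasurable (by fun_prop)) (hVx x hx).1)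
    hkb
    (fun x _ t _ _ _ => by
      refine HolCont.mul (HolCont.div (HolCont.of_differentiable (by fun_prop))
        (HolCont.of_differentiable (by fun_prop)) fun ρ hρ => ?_) (HolCont.const _)
      exact mul_ne_zero (mul_ne_zero two_ne_zero Complex.I_ne_zero) (hne ρ hρ))
    (fun x hx => (hVx x hx).norm.div_const δ)
    (fun ρ hρ g C hg hC _ => by
      simp only [Finset.univ_unique, Finset.sum_singleton]
      exact (hprimw ρ hρ (fun t => g t ()) (hg ()) C fun t ht => hC t ht ()).continuousOn)
    (fun _ => continuousOn_const)
    (fun n x hx => by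
      rw [integral_mul_const, integral_div, pow_succ]
      simp only [Fintype.card_unit, Nat.cast_one, one_mul]
      have : (∫ t in Ioi x, ‖P.V t‖) / δ ≤ 1 / 2 := by
        rw [div_le_iff₀ hδ]
        linarith [hVεx x hx]
      nlinarith [pow_pos (by norm_num : (0 : ℝ) < 1 / 2) n])
    (fun _ _ _ => le_rfl) (summable_geometric_of_lt_one (by norm_num) (by norm_num))
    (fun _ _ _ => continuousOn_const) (fun _ _ _ => HolCont.const _)
    (fun _ _ _ _ _ => by simp)
  rw [tsum_geometric_of_lt_one (by norm_num) (by norm_num)] at hwb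
  have hwb' : ∀ ρ ∈ S, ∀ x ∈ Ici R, ‖w ρ x ()‖ ≤ 2 := fun ρ hρ x hx =>
    (hwb ρ hρ x hx ()).trans (by norm_num)
  have hwe' : ∀ ρ ∈ S, ∀ x ∈ Ici R, w ρ x () = 1 + ∫ t in Ioi x, k ρ x t () () * w ρ t () := by
    intro ρ hρ x hx
    rw [hwe ρ hρ x hx ()]
    simp
  have hw1 : ∀ ρ ∈ S, ∀ x ∈ Ici R, ‖w ρ x () - 1‖ ≤ 2 / δ * ∫ t in Ioi x, ‖P.V t‖ := by
    intro ρ hρ x hx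
    rw [hwe' ρ hρ x hx, add_sub_cancel_left, ← integral_const_mul]
    refine norm_integral_le_of_norm_le ((hVx x hx).norm.const_mul _)
      ((ae_restrict_iff' measurableSet_Ioi).2 (Eventually.of_forall fun t ht => ?_))
    rw [norm_mul]
    calc _ ≤ ‖P.V t‖ / δ * 2 := mul_le_mul (hkb ρ hρ x hx t ht () ())
          (hwb' ρ hρ t (Ioi_subset_Ici_self (Ioi_subset_Ioi hx ht))) (norm_nonneg _) (by positivity)
      _ = _ := by ring
  let u : ℂ → ℝ → ℂ := fun ρ x => -(Complex.exp (-(2 * Complex.I) * ρ * x) *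
    ∫ t in Ioi x, Complex.exp (2 * Complex.I * ρ * t) * (P.V t * w ρ t ()))
  have hwu : ∀ ρ ∈ S, IsPrimitiveOn (Ici R) (fun x => w ρ x ()) (u ρ) := by
    intro ρ hρ
    refine ((IsPrimitiveOn.const 1).add (hprimw ρ hρ (fun t => w ρ t ()) (hwc ρ hρ ()) 2
      (hwb' ρ hρ))).congr (hwe' ρ hρ) fun x _ => ?_
    simp [u]
  have huu : ∀ ρ ∈ S, IsPrimitiveOn (Ici R) (u ρ)
      fun x => -(2 * Complex.I) * ρ * u ρ x + P.V x * w ρ x () := by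
    intro ρ hρ
    refine ((hprim ρ hρ (fun t => w ρ t ()) (hwc ρ hρ ()) 2 (hwb' ρ hρ)).const_mul (-1)).congr
      (fun x _ => ?_) fun x _ => ?_
    · simp [u]
    · simp only [u]
      ring
  -- Recombined, the exponential is exp(2iρ(t-R)), of modulus at most 1, which gives a majorant
  -- uniform in ρ.
  have huR : HolCont S fun ρ => u ρ R := by
    have : HolCont S fun ρ => -∫ t in Ioi R,
        Complex.exp (2 * Complex.I * ρ * (t - R : ℝ)) * (P.V t * w ρ t ()) := by
      refine HolCont.neg (HolCont.integral (b := fun t => ‖P.V t‖ * 2) (fun ρ hρ => ?_) ?_ ?_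
        (hV.norm.mul_const 2))
      · exact AEStronglyMeasurable.mul (Continuous.aestronglyMeasurable (by fun_prop))
          (hexp ρ (fun t => w ρ t ()) (hwc ρ hρ ()) 2 (hwb' ρ hρ)).1
      · refine (ae_restrict_iff' measurableSet_Ioi).2 (Eventually.of_forall fun t ht ρ hρ => ?_)
        rw [norm_mul, norm_mul]
        calc _ ≤ 1 * (‖P.V t‖ * ‖w ρ t ()‖) := by
              gcongr
              exact norm_exp_two_I_mul_le hρ.1 (sub_nonneg.2 (le_of_lt ht))
          _ ≤ _ := by
              rw [one_mul]
              gcongr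
              exact hwb' ρ hρ t (Ioi_subset_Ici_self ht)
      · refine (ae_restrict_iff' measurableSet_Ioi).2 (Eventually.of_forall fun t ht => ?_)
        exact (HolCont.of_differentiable (by fun_prop)).mul
          ((HolCont.const _).mul (hwh t (Ioi_subset_Ici_self ht) ()))
    refine this.congr fun ρ _ => ?_
    simp only [u]
    rw [← integral_const_mul]
    congr 1
    refine integral_congr_ae (Eventually.of_forall fun t => ?_)
    simp only
    rw [← mul_assoc, ← Complex.exp_add]
    congr 2
    push_cast
    ring
  refine ⟨R, hR, fun ρ x => Complex.exp (Complex.I * ρ * x) * w ρ x (),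
    fun ρ x => Complex.exp (Complex.I * ρ * x) * (Complex.I * ρ * w ρ x () + u ρ x),
    fun ρ hρ => ⟨⟨?_, ?_⟩, fun x hx => ?_, ?_⟩, ?_, ?_⟩
  · exact ((hexpd ρ Complex.I).mul (hwu ρ hρ)).congr (fun _ _ => rfl) fun x _ => by ring
  · refine ((hexpd ρ Complex.I).mul (((hwu ρ hρ).const_mul (Complex.I * ρ)).add (huu ρ hρ))).congr
      (fun _ _ => rfl) fun x _ => ?_
    linear_combination (-(ρ ^ 2) * Complex.exp (Complex.I * ρ * x) * w ρ x ()) * Complex.I_sq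
  · refine mul_ne_zero (Complex.exp_ne_zero _) fun h0 => ?_
    have h1 := hw1 ρ hρ x hx
    rw [h0, zero_sub, norm_neg, norm_one] at h1
    have h2 : 2 / δ * ∫ t in Ioi x, ‖P.V t‖ ≤ 2 / δ * (δ / 4) := by
      gcongr
      exact hVεx x hx
    have h3 : 2 / δ * (δ / 4) = 1 / 2 := by field_simp; norm_num
    linarith
  · have hlim : Tendsto (fun x : ℝ => 2 / δ * ∫ t in Ioi x, ‖P.V t‖) atTop (𝓝 0) := by
      simpa using (tendsto_integral_Ioi_zero (f := fun t => ‖P.V t‖)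
        tendsto_id).const_mul (2 / δ)
    have hw : Tendsto (fun x => w ρ x ()) atTop (𝓝 1) := by
      rw [tendsto_iff_norm_sub_tendsto_zero]
      refine squeeze_zero' (Eventually.of_forall fun x => norm_nonneg _) ?_ hlim
      filter_upwards [eventually_ge_atTop R] with x hx using hw1 ρ hρ x hx
    refine hw.congr fun x => ?_
    rw [mul_right_comm, ← Complex.exp_add, show Complex.I * ρ * x + -Complex.I * ρ * x = 0 by ring,
      Complex.exp_zero, one_mul]
  · exact (HolCont.of_differentiable (by fun_prop)).mul (hwh R self_mem_Ici ())
  · exact (HolCont.of_differentiable (by fun_prop)).mul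
      (((HolCont.of_differentiable (by fun_prop)).mul (hwh R self_mem_Ici ())).add huR)

end SLProblem

/-! ### Uniqueness of the Jost solution. -/

theorem exp_two_I_mul_inv_norm_ne_one {ρ : ℂ} (hρ : ρ ≠ 0) :
    Complex.exp (2 * Complex.I * ρ * (‖ρ‖⁻¹ : ℝ)) ≠ 1 := by
  intro h
  obtain ⟨n, hn⟩ := Complex.exp_eq_one_iff.1 h
  have h1 : ρ * (‖ρ‖⁻¹ : ℝ) = n * Real.pi := by
    have hI : (2 * Complex.I) ≠ 0 := mul_ne_zero two_ne_zero Complex.I_ne_zero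
    refine mul_left_cancel₀ hI ?_
    -- Hence ρ/|ρ|, of modulus 1, would be an integer multiple of π. Shifting x by 1/|ρ| therefore
    -- always changes exp(2iρx), which tells e^{iρx} from e^{-iρx} even for real ρ, when neither
    -- decays.
    linear_combination hn
  have h2 := congrArg norm h1
  rw [norm_mul, norm_mul, Complex.norm_real, Complex.norm_real, norm_inv, norm_norm,
    mul_inv_cancel₀ (norm_ne_zero_iff.2 hρ), Complex.norm_intCast,
    Real.norm_of_nonneg Real.pi_pos.le] at h2
  have h3 := Real.pi_gt_three
  rcases eq_or_ne n 0 with rfl | hn0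
  · simp at h2
  · have : (1 : ℝ) ≤ |(n : ℝ)| := by exact_mod_cast Int.one_le_abs hn0
    nlinarith

namespace SLProblem

variable {P : SLProblem}

set_option maxHeartbeats 400000 in
/-- A solution that is negligible against the Jost solution vanishes. -/
theorem IsSolutionOn.eq_zero_of_tendsto_zero {R : ℝ} {ρ : ℂ} (hρ : 0 ≤ ρ.im) (hρ0 : ρ ≠ 0)
    {y dy e de : ℝ → ℂ} (hy : P.IsSolutionOn (Ici R) (ρ ^ 2) y dy)
    (he : P.IsSolutionOn (Ici R) (ρ ^ 2) e de) (hne : ∀ x ∈ Ici R, e x ≠ 0)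
    (helim : Tendsto (fun x : ℝ => e x * Complex.exp (-Complex.I * ρ * x)) atTop (𝓝 1))
    (hylim : Tendsto (fun x : ℝ => y x * Complex.exp (-Complex.I * ρ * x)) atTop (𝓝 0))
    {x : ℝ} (hx : R < x) : y x = 0 ∧ dy x = 0 := by
  have hI : Complex.I ≠ 0 := Complex.I_ne_zero
  -- The quotient y/e has derivative -c/e², comparable with -c exp(-2iρx). Once c = 0 is known, y/e
  -- is constant with limit 0.
  set c := y R * de R - dy R * e R with hc
  have hW : ∀ x ∈ Ici R, y x * de x - dy x * e x = c := fun x hx =>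
    hy.wronskian_eq he hx self_mem_Ici
  let E2 : ℝ → ℂ := fun x => Complex.exp (-(2 * Complex.I * ρ * x))
  let D : ℝ → ℂ := fun x => Complex.exp (2 * Complex.I * ρ * x)
  have hDE : ∀ x, D x * E2 x = 1 := fun x => by
    simp only [D, E2, ← Complex.exp_add, add_neg_cancel, Complex.exp_zero]
  have hE2 : ∀ x : ℝ, Complex.exp (-Complex.I * ρ * x) ^ 2 = E2 x := fun x => by
    rw [← Complex.exp_nat_mul]
    congr 1
    push_cast
    ring
  let z : ℝ → ℂ := fun x => e x * Complex.exp (-Complex.I * ρ * x)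
  have hz : ∀ x ∈ Ici R, z x ≠ 0 := fun x hx => mul_ne_zero (hne x hx) (Complex.exp_ne_zero _)
  have hze : ∀ x ∈ Ici R, -c / e x ^ 2 = -c * E2 x * (z x ^ 2)⁻¹ := by
    intro x hx
    have h1 := hne x hx
    have h2 := hz x hx
    have h3 : z x ^ 2 = e x ^ 2 * E2 x := by rw [← hE2]; ring
    have h4 : E2 x ≠ 0 := Complex.exp_ne_zero _
    rw [h3]
    field_simp
  let f : ℝ → ℂ := fun x => y x / e x
  have hf : ∀ x, R < x → HasDerivAt f (-c / e x ^ 2) x := by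
    intro x hx
    have h1 := (hy.hasDerivWithinAt (x := x) hx.le).hasDerivAt (Ici_mem_nhds hx)
    have h2 := (he.hasDerivWithinAt (x := x) hx.le).hasDerivAt (Ici_mem_nhds hx)
    refine (h1.div h2 (hne x hx.le)).congr_deriv ?_
    rw [← hW x hx.le]
    ring
  have hf0 : Tendsto f atTop (𝓝 0) := by
    have := hylim.div helim one_ne_zero
    rw [zero_div] at this
    refine this.congr fun x => ?_
    exact mul_div_mul_right _ _ (Complex.exp_ne_zero _)
  have hc0 : c = 0 := by
    let hh := ‖ρ‖⁻¹
    have hpos : 0 < hh := inv_pos.2 (norm_pos_iff.2 hρ0)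
    -- The antiderivative of the leading term is subtracted. Scaled by `D`, the increments of f and
    -- of g over the step 1/|ρ| both tend to 0, while their difference is a fixed nonzero multiple
    -- of c.
    let g : ℝ → ℂ := fun x => f x - c / (2 * Complex.I * ρ) * E2 x
    have hE2d : ∀ x, HasDerivAt E2 (-(2 * Complex.I * ρ) * E2 x) x := by
      intro x
      have := ((Complex.ofRealCLM.hasDerivAt (x := x)).const_mul (2 * Complex.I * ρ)).neg.cexp
      refine this.congr_deriv ?_
      simp [E2, mul_comm]
    have hg : ∀ x, R < x → HasDerivAt g (-c * E2 x * ((z x ^ 2)⁻¹ - 1)) x := by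
      intro x hx
      refine ((hf x hx).sub ((hE2d x).const_mul (c / (2 * Complex.I * ρ)))).congr_deriv ?_
      rw [hze x hx.le]
      field_simp
      ring
    let M := Real.exp (2 * ρ.im * hh)
    have hE2b : ∀ x t : ℝ, t ∈ Icc x (x + hh) → ‖E2 t‖ ≤ ‖E2 x‖ * M := by
      intro x t ht
      simp only [E2, M]
      rw [Complex.norm_exp, Complex.norm_exp, ← Real.exp_add]
      refine Real.exp_le_exp.2 ?_
      have e1 : ∀ u : ℝ, (-(2 * Complex.I * ρ * u)).re = 2 * ρ.im * u := fun u => by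
        simp [Complex.mul_re, Complex.mul_im]
      rw [e1, e1, ← mul_add]
      gcongr
      exact ht.2
    have hzlim : Tendsto (fun x => (z x ^ 2)⁻¹ - 1) atTop (𝓝 0) := by
      have h1 : Tendsto z atTop (𝓝 1) := helim
      simpa using ((h1.pow 2).inv₀ (by norm_num)).sub_const 1
    have hglim : Tendsto (fun x => D x * (g (x + hh) - g x)) atTop (𝓝 0) := by
      rw [Metric.tendsto_nhds]
      intro ε hε
      have hK : 0 < ‖c‖ * M * hh + 1 := by positivity
      have hev := (Metric.tendsto_nhds.1 hzlim) (ε / (‖c‖ * M * hh + 1)) (by positivity)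
      obtain ⟨X, hX⟩ := eventually_atTop.1 hev
      filter_upwards [eventually_ge_atTop X, eventually_gt_atTop R] with x hxX hxR
      have hmv := (convex_Icc x (x + hh)).norm_image_sub_le_of_norm_hasDerivWithin_le
        (f := g) (f' := fun t => -c * E2 t * ((z t ^ 2)⁻¹ - 1))
        (C := ‖c‖ * (‖E2 x‖ * M) * (ε / (‖c‖ * M * hh + 1)))
        (fun t ht => (hg t (hxR.trans_le ht.1)).hasDerivWithinAt)
        (fun t ht => by
          rw [norm_mul, norm_mul, norm_neg]
          have h1 := hX t (hxX.trans ht.1)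
          rw [dist_zero_right] at h1
          gcongr
          exact hE2b x t ht)
        (left_mem_Icc.2 (by linarith)) (right_mem_Icc.2 (by linarith))
      have h2 : ‖D x‖ * ‖E2 x‖ = 1 := by rw [← norm_mul, hDE, norm_one]
      have h3 : ‖x + hh - x‖ = hh := by
        rw [add_sub_cancel_left]
        exact Real.norm_of_nonneg hpos.le
      rw [h3] at hmv
      rw [dist_zero_right, norm_mul]
      calc ‖D x‖ * ‖g (x + hh) - g x‖
          ≤ ‖D x‖ * (‖c‖ * (‖E2 x‖ * M) * (ε / (‖c‖ * M * hh + 1)) * hh) := by gcongr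
        _ = ‖c‖ * M * hh / (‖c‖ * M * hh + 1) * ε := by
            linear_combination (‖c‖ * M * (ε / (‖c‖ * M * hh + 1)) * hh) * h2
        _ < 1 * ε := by
            gcongr
            rw [div_lt_one hK]
            linarith
        _ = ε := one_mul ε
    have hflim : Tendsto (fun x => D x * (f (x + hh) - f x)) atTop (𝓝 0) := by
      have h1 : Tendsto (fun x => f (x + hh) - f x) atTop (𝓝 0) := by
        simpa using (hf0.comp (tendsto_atTop_add_const_right atTop hh tendsto_id)).sub hf0
      refine squeeze_zero_norm' ?_ (by simpa using h1.norm)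
      filter_upwards [eventually_ge_atTop 0] with x hx
      rw [norm_mul]
      exact mul_le_of_le_one_left (norm_nonneg _) (norm_exp_two_I_mul_le hρ hx)
    have hdiff := hflim.sub hglim
    have hconst : ∀ x, D x * (f (x + hh) - f x) - D x * (g (x + hh) - g x) =
        c / (2 * Complex.I * ρ) * (E2 hh - 1) := by
      intro x
      have h1 : E2 (x + hh) = E2 x * E2 hh := by
        simp only [E2, ← Complex.exp_add]
        congr 1
        push_cast
        ring
      simp only [g, h1]
      linear_combination (c / (2 * Complex.I * ρ) * (E2 hh - 1)) * hDE x
    simp only [hconst, sub_zero] at hdiff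
    have h0 := tendsto_nhds_unique hdiff tendsto_const_nhds
    have hE1 : E2 hh - 1 ≠ 0 := by
      intro h1
      have h2 := hDE hh
      rw [sub_eq_zero.1 h1, mul_one] at h2
      exact exp_two_I_mul_inv_norm_ne_one hρ0 h2
    have := (mul_eq_zero.1 h0.symm).resolve_right hE1
    have h3 : 2 * Complex.I * ρ ≠ 0 := mul_ne_zero (mul_ne_zero two_ne_zero hI) hρ0
    exact (div_eq_zero_iff.1 this).resolve_right h3
  have hfc : ∀ t ∈ Ioi R, f t = f x := by
    intro t ht
    have := (convex_Ioi R).norm_image_sub_le_of_norm_hasDerivWithin_le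
      (f := f) (f' := fun t => -c / e t ^ 2) (C := 0)
      (fun t ht => (hf t ht).hasDerivWithinAt) (fun t _ => by simp [hc0]) (x := x) (y := t) hx ht
    rw [zero_mul] at this
    exact sub_eq_zero.1 (norm_le_zero_iff.1 this)
  have hfx : f x = 0 := by
    refine tendsto_nhds_unique ?_ hf0
    refine tendsto_const_nhds.congr' ?_
    filter_upwards [eventually_gt_atTop R] with t ht using (hfc t ht).symm
  have hyx : y x = 0 := (div_eq_zero_iff.1 hfx).resolve_right (hne x hx.le)
  refine ⟨hyx, ?_⟩
  have := hW x hx.le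
  rw [hyx, hc0, zero_mul, zero_sub, neg_eq_zero] at this
  exact (mul_eq_zero.1 this).resolve_right (hne x hx.le)

/-! ### The coefficients A_k(ρ) of the Jost solution. -/

/-- The derivative of `σ_j(x, λ)` with respect to `x`, for `x > a`. -/
def dσ (P : SLProblem) (j : Fin 2) (x : ℝ) (lam : ℂ) : ℂ := ∑ k : Fin 2, P.A k j * P.ds k x lam

theorem Ioi_subset_dom (h : P.Admissible) : Ioi P.a ⊆ P.dom :=
  fun _ hx => ⟨h.a_pos.le.trans (le_of_lt hx), ne_of_gt hx⟩

theorem σ_of_lt {x : ℝ} (hx : P.a < x) (j : Fin 2) (lam : ℂ) :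
    P.σ j x lam = P.A 0 j * P.s 0 x lam + P.A 1 j * P.s 1 x lam := by
  rw [σ, if_neg hx.not_gt, Fin.sum_univ_two]

theorem Admissible.isSolutionOn_σ (h : P.Admissible) (j : Fin 2) (lam : ℂ) :
    P.IsSolutionOn (Ioi P.a) lam (fun x => P.σ j x lam) fun x => P.dσ j x lam := by
  have h1 := (h.isSolutionOn_s (Ioi_subset_dom h) 0 lam).linear_comb
    (h.isSolutionOn_s (Ioi_subset_dom h) 1 lam) (P.A 0 j) (P.A 1 j)
  refine ⟨h1.1.congr (fun x hx => σ_of_lt hx j lam) fun x _ => ?_,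
    h1.2.congr (fun x _ => ?_) fun x hx => ?_⟩
  · rw [dσ, Fin.sum_univ_two]
  · rw [dσ, Fin.sum_univ_two]
  · beta_reduce
    rw [σ_of_lt hx]

theorem Admissible.wronskian_σ (h : P.Admissible) (lam : ℂ) {x : ℝ} (hx : P.a < x) :
    P.σ 0 x lam * P.dσ 1 x lam - P.dσ 0 x lam * P.σ 1 x lam = P.A.det := by
  rw [σ_of_lt hx, σ_of_lt hx, dσ, dσ, Fin.sum_univ_two, Fin.sum_univ_two, Matrix.det_fin_two]
  linear_combination (P.A 0 0 * P.A 1 1 - P.A 0 1 * P.A 1 0) *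
    h.wronskian_s lam (Ioi_subset_dom h hx)

theorem Admissible.holCont_σ (h : P.Admissible) (S : Set ℂ) (j : Fin 2) {x : ℝ} (hx : P.a < x) :
    HolCont S (fun ρ => P.σ j x (ρ ^ 2)) ∧ HolCont S fun ρ => P.dσ j x (ρ ^ 2) := by
  have hd := Ioi_subset_dom h hx
  have hs := fun k => (h.differentiable_s k hd).comp (differentiable_pow (𝕜 := ℂ) 2)
  have hds := fun k => (h.differentiable_ds k hd).comp (differentiable_pow (𝕜 := ℂ) 2)
  constructor
  · simp only [σ_of_lt hx]
    exact HolCont.of_differentiable (((hs 0).const_mul _).add ((hs 1).const_mul _))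
  · simp only [dσ, Fin.sum_univ_two]
    exact HolCont.of_differentiable (((hds 0).const_mul _).add ((hds 1).const_mul _))

/-- Cramer's rule at x = R: the Wronskian of σ₁, σ₂ is det A, so the coefficients are Wronskians
with the Jost solution divided by det A. -/
theorem Admissible.exists_isJostCoeff (h : P.Admissible) (hA : P.A.det ≠ 0) {δ : ℝ} (hδ : 0 < δ) :
    ∃ B : ℂ → Fin 2 → ℂ, (∀ ρ ∈ upperOutside δ, P.IsJostCoeff ρ (B ρ)) ∧
      ∀ k, HolCont (upperOutside δ) fun ρ => B ρ k := by
  obtain ⟨R, hR, e, de, he, heR, hdeR⟩ := h.exists_jost hδ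
  let B : ℂ → Fin 2 → ℂ := fun ρ =>
    ![(e ρ R * P.dσ 1 R (ρ ^ 2) - de ρ R * P.σ 1 R (ρ ^ 2)) * P.A.det⁻¹,
      (de ρ R * P.σ 0 R (ρ ^ 2) - e ρ R * P.dσ 0 R (ρ ^ 2)) * P.A.det⁻¹]
  refine ⟨B, fun ρ hρ => ?_, fun k => ?_⟩
  · obtain ⟨hsol, -, hlim⟩ := he ρ hρ
    refine hlim.congr' ?_
    filter_upwards [eventually_ge_atTop R] with x hx
    have hsub : Ici R ⊆ Ioi P.a := Ici_subset_Ioi.2 hR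
    have hσ : ∀ j, P.IsSolutionOn (Ici R) (ρ ^ 2) (fun x => P.σ j x (ρ ^ 2))
        fun x => P.dσ j x (ρ ^ 2) := fun j =>
      ⟨(h.isSolutionOn_σ j _).1.mono hsub, (h.isSolutionOn_σ j _).2.mono hsub⟩
    have h0 := hsol.wronskian_eq (hσ 0) (s := R) (t := x) self_mem_Ici hx
    have h1 := hsol.wronskian_eq (hσ 1) (s := R) (t := x) self_mem_Ici hx
    have h2 := h.wronskian_σ (ρ ^ 2) (hR.trans_le hx)
    congr 1
    simp only [Fin.sum_univ_two, B, Matrix.cons_val_zero, Matrix.cons_val_one]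
    have h3 := mul_inv_cancel₀ hA
    linear_combination (-(P.A.det⁻¹ * P.σ 0 x (ρ ^ 2))) * h1 +
      P.A.det⁻¹ * P.σ 1 x (ρ ^ 2) * h0 - P.A.det⁻¹ * e ρ x * h2 - e ρ x * h3
  · obtain ⟨hσ0, hdσ0⟩ := h.holCont_σ (upperOutside δ) 0 hR
    obtain ⟨hσ1, hdσ1⟩ := h.holCont_σ (upperOutside δ) 1 hR
    fin_cases k
    · exact ((heR.mul hdσ1).sub (hdeR.mul hσ1)).mul (HolCont.const _)
    · exact ((hdeR.mul hσ0).sub (heR.mul hdσ0)).mul (HolCont.const _)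

theorem Admissible.isJostCoeff_unique (h : P.Admissible) (hA : P.A.det ≠ 0) {ρ : ℂ}
    (hρ : 0 ≤ ρ.im) (hρ0 : ρ ≠ 0) {B B' : Fin 2 → ℂ} (hB : P.IsJostCoeff ρ B)
    (hB' : P.IsJostCoeff ρ B') : B = B' := by
  have hpos : 0 < ‖ρ‖ := norm_pos_iff.2 hρ0
  obtain ⟨R, hR, e, de, he, -, -⟩ := h.exists_jost (δ := ‖ρ‖ / 2) (by positivity)
  obtain ⟨hsol, hne, hlim⟩ := he ρ ⟨hρ, by linarith⟩
  have hsub : Ici R ⊆ Ioi P.a := Ici_subset_Ioi.2 hR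
  have hσ : ∀ j, P.IsSolutionOn (Ici R) (ρ ^ 2) (fun x => P.σ j x (ρ ^ 2))
      fun x => P.dσ j x (ρ ^ 2) := fun j =>
    ⟨(h.isSolutionOn_σ j _).1.mono hsub, (h.isSolutionOn_σ j _).2.mono hsub⟩
  have hy := (hσ 0).linear_comb (hσ 1) (B 0 - B' 0) (B 1 - B' 1)
  have hylim := Tendsto.sub hB hB'
  rw [sub_self] at hylim
  obtain ⟨h1, h2⟩ := hy.eq_zero_of_tendsto_zero hρ hρ0 hsol hne hlim (x := R + 1)
    (hylim.congr fun x => by simp only [Fin.sum_univ_two]; ring) (by linarith)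
  have hW := h.wronskian_σ (ρ ^ 2) (x := R + 1) (by linarith)
  ext i
  fin_cases i
  · refine mul_right_cancel₀ hA ?_
    simp only [Fin.zero_eta]
    rw [← hW]
    linear_combination P.dσ 1 (R + 1) (ρ ^ 2) * h1 - P.σ 1 (R + 1) (ρ ^ 2) * h2
  · refine mul_right_cancel₀ hA ?_
    simp only [Fin.mk_one]
    rw [← hW]
    linear_combination P.σ 0 (R + 1) (ρ ^ 2) * h2 - P.dσ 0 (R + 1) (ρ ^ 2) * h1

theorem Admissible.isJostCoeff_jostCoeff (h : P.Admissible) (hA : P.A.det ≠ 0) {ρ : ℂ}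
    (hρ : 0 ≤ ρ.im) (hρ0 : ρ ≠ 0) : P.IsJostCoeff ρ (P.jostCoeff ρ) := by
  have hpos : 0 < ‖ρ‖ := norm_pos_iff.2 hρ0
  obtain ⟨B, hB, -⟩ := h.exists_isJostCoeff hA (δ := ‖ρ‖ / 2) (by positivity)
  have hex : ∃ B : Fin 2 → ℂ, P.IsJostCoeff ρ B := ⟨B ρ, hB ρ ⟨hρ, by linarith⟩⟩
  rw [jostCoeff, dif_pos hex]
  exact hex.choose_spec

/-- The constructed coefficients come from a base point R depending on δ; uniqueness identifies them
with the chosen ones, which do not depend on δ. -/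
theorem Admissible.holCont_jostCoeff (h : P.Admissible) (hA : P.A.det ≠ 0) {δ : ℝ} (hδ : 0 < δ)
    (k : Fin 2) : HolCont (upperOutside δ) fun ρ => P.jostCoeff ρ k := by
  obtain ⟨B, hB, hBh⟩ := h.exists_isJostCoeff hA hδ
  refine (hBh k).congr fun ρ hρ => ?_
  have hρ0 : ρ ≠ 0 := norm_pos_iff.1 (hδ.trans hρ.2)
  rw [h.isJostCoeff_unique hA hρ.1 hρ0 (hB ρ hρ) (h.isJostCoeff_jostCoeff hA hρ.1 hρ0)]

theorem IsJostCoeff.ne_zero {ρ : ℂ} {B : Fin 2 → ℂ} (hB : P.IsJostCoeff ρ B) : B ≠ 0 := by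
  rintro rfl
  simp [IsJostCoeff] at hB

/-- The Jost solutions with parameters `ρ` and `-ρ` are linearly independent. -/
theorem IsJostCoeff.det_ne_zero {ρ : ℂ} (hρ0 : ρ ≠ 0) {B B' : Fin 2 → ℂ}
    (hB : P.IsJostCoeff ρ B) (hB' : P.IsJostCoeff (-ρ) B') : B 0 * B' 1 - B 1 * B' 0 ≠ 0 := by
  intro hdet
  -- If the coefficient vectors were proportional, dividing the two asymptotics would give c
  -- exp(2iρx) → 1; a shift of x by 1/|ρ| contradicts this.
  obtain ⟨c, hc⟩ : ∃ c : ℂ, ∀ k, B' k = c * B k := by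
    by_cases h0 : B 0 = 0
    · have h1 : B 1 ≠ 0 := by
        intro h1
        refine hB.ne_zero ?_
        ext i
        fin_cases i
        · exact h0
        · exact h1
      refine ⟨B' 1 / B 1, fun k => ?_⟩
      fin_cases k
      · simp only [Fin.zero_eta]
        rw [h0] at hdet ⊢
        have : B 1 * B' 0 = 0 := by linear_combination -hdet
        rw [(mul_eq_zero.1 this).resolve_left h1, mul_zero]
      · simp only [Fin.mk_one]
        field_simp
    · refine ⟨B' 0 / B 0, fun k => ?_⟩
      fin_cases k
      · simp only [Fin.zero_eta]
        field_simp
      · simp only [Fin.mk_one]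
        field_simp
        linear_combination hdet
  have hlim : Tendsto (fun x : ℝ => c * Complex.exp (2 * Complex.I * ρ * x)) atTop (𝓝 1) := by
    have h1 := Tendsto.div hB' hB one_ne_zero
    rw [div_one] at h1
    refine h1.congr' ?_
    have hev := Tendsto.eventually_ne hB one_ne_zero
    filter_upwards [hev] with x hx
    simp only [Pi.div_apply, Fin.sum_univ_two, neg_sq, hc] at hx ⊢
    rw [div_eq_iff hx]
    have : Complex.exp (-Complex.I * -ρ * x) =
        Complex.exp (2 * Complex.I * ρ * x) * Complex.exp (-Complex.I * ρ * x) := by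
      rw [← Complex.exp_add]
      congr 1
      ring
    rw [this]
    ring
  have h2 : Tendsto (fun x : ℝ => c * Complex.exp (2 * Complex.I * ρ * (x + ‖ρ‖⁻¹ : ℝ))) atTop
      (𝓝 1) := hlim.comp (tendsto_atTop_add_const_right atTop ‖ρ‖⁻¹ tendsto_id)
  have h3 := hlim.mul_const (Complex.exp (2 * Complex.I * ρ * (‖ρ‖⁻¹ : ℝ)))
  rw [one_mul] at h3
  refine exp_two_I_mul_inv_norm_ne_one hρ0 (tendsto_nhds_unique (h3.congr fun x => ?_) h2)
  rw [mul_assoc, ← Complex.exp_add]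
  congr 2
  push_cast
  ring

end SLProblem

/-! ### The upper half-plane and the map ρ ↦ ρ². -/

/-- The closed upper half-plane without the origin. -/
def closedUpper : Set ℂ := {ρ | 0 ≤ ρ.im ∧ ρ ≠ 0}

/-- The open upper half-plane. -/
def openUpper : Set ℂ := {ρ | 0 < ρ.im}

theorem isOpen_openUpper : IsOpen openUpper := isOpen_lt continuous_const Complex.continuous_im

theorem openUpper_subset_closedUpper : openUpper ⊆ closedUpper := by
  intro ρ hρ
  refine ⟨le_of_lt hρ, ?_⟩
  rintro rfl
  exact lt_irrefl _ (show (0 : ℝ) < (0 : ℂ).im from hρ)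

theorem isPreconnected_openUpper : IsPreconnected openUpper :=
  (convex_halfSpace_im_gt 0).isPreconnected

theorem closedUpper_subset_closure {ρ : ℂ} (hρ : ρ ∈ closedUpper) : ρ ∈ closure openUpper := by
  have h : Tendsto (fun n : ℕ => ρ + (1 / ((n : ℝ) + 1) : ℝ) * Complex.I) atTop (𝓝 ρ) := by
    have h1 := (Complex.continuous_ofReal.tendsto 0).comp
      (tendsto_one_div_add_atTop_nhds_zero_nat (𝕜 := ℝ))
    simpa using (h1.mul_const Complex.I).const_add ρ
  refine mem_closure_of_tendsto h (Eventually.of_forall fun n => ?_)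
  have : (0 : ℝ) < 1 / ((n : ℝ) + 1) := by positivity
  have h2 := hρ.1
  simp only [openUpper, mem_ofPred_eq, Complex.add_im, Complex.im_ofReal_mul,
    Complex.I_im, mul_one]
  linarith

/-- Both properties are local, and δ = |ρ|/2 serves at the point ρ. -/
theorem continuousOn_and_differentiableOn_of_holCont {f : ℂ → ℂ} (hf : ∀ δ > 0, HolCont (upperOutside δ) f) :
    ContinuousOn f closedUpper ∧ DifferentiableOn ℂ f openUpper := by
  have hopen : ∀ δ : ℝ, IsOpen {ρ : ℂ | δ < ‖ρ‖} := fun δ =>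
    isOpen_lt continuous_const continuous_norm
  constructor
  · intro ρ hρ
    have hpos : 0 < ‖ρ‖ := norm_pos_iff.2 hρ.2
    refine ((hf (‖ρ‖ / 2) (by positivity)).1 ρ ⟨hρ.1, by linarith⟩).mono_of_mem_nhdsWithin ?_
    refine mem_of_superset (inter_mem_nhdsWithin closedUpper
      ((hopen (‖ρ‖ / 2)).mem_nhds (show ‖ρ‖ / 2 < ‖ρ‖ by linarith))) ?_
    exact fun z hz => ⟨hz.1.1, hz.2⟩
  · intro ρ hρ
    have hpos : 0 < ‖ρ‖ := norm_pos_iff.2 (openUpper_subset_closedUpper hρ).2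
    have hsub : openUpper ∩ {z : ℂ | ‖ρ‖ / 2 < ‖z‖} ⊆ interior (upperOutside (‖ρ‖ / 2)) :=
      interior_maximal (fun z hz => ⟨le_of_lt hz.1, hz.2⟩) (isOpen_openUpper.inter (hopen _))
    have hmem : ρ ∈ openUpper ∩ {z : ℂ | ‖ρ‖ / 2 < ‖z‖} :=
      ⟨hρ, show ‖ρ‖ / 2 < ‖ρ‖ by linarith⟩
    exact ((hf (‖ρ‖ / 2) (by positivity)).2.differentiableAt
      (isOpen_interior.mem_nhds (hsub hmem))).differentiableWithinAt

theorem sq_mem_PiPlus {ρ : ℂ} (hρ : ρ ∈ openUpper) : ρ ^ 2 ∈ PiPlus := by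
  rintro ⟨h1, h2⟩
  have hρ' : 0 < ρ.im := hρ
  simp only [sq, Complex.mul_re, Complex.mul_im] at h1 h2
  have h3 : ρ.re = 0 := by
    have : ρ.re * ρ.im = 0 := by linarith
    exact (mul_eq_zero.1 this).resolve_right hρ'.ne'
  rw [h3] at h1
  nlinarith

theorem sq_inj_openUpper {ρ ρ' : ℂ} (hρ : ρ ∈ openUpper) (hρ' : ρ' ∈ openUpper)
    (h : ρ ^ 2 = ρ' ^ 2) : ρ = ρ' := by
  rcases sq_eq_sq_iff_eq_or_eq_neg.1 h with h | h
  · exact h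
  · have h1 : 0 < ρ.im := hρ
    have h2 : 0 < ρ'.im := hρ'
    rw [h, Complex.neg_im] at h1
    linarith

theorem upperRoot_sq_of_openUpper {ρ : ℂ} (hρ : ρ ∈ openUpper) : upperRoot (ρ ^ 2) = ρ :=
  sq_inj_openUpper (upperRoot_im_pos (sq_mem_PiPlus hρ)) hρ (upperRoot_sq _)

theorem isOpen_PiPlus : IsOpen PiPlus := by
  have : IsClosed rayPlus :=
    (isClosed_le continuous_const Complex.continuous_re).inter
      (isClosed_eq Complex.continuous_im continuous_const)
  exact this.isOpen_compl

theorem neg_mem_slitPlane {z : ℂ} (hz : z ∈ PiPlus) : -z ∈ Complex.slitPlane := by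
  rw [Complex.mem_slitPlane_iff, Complex.neg_re, Complex.neg_im]
  by_contra! h
  exact hz ⟨by linarith [h.1], neg_eq_zero.1 h.2⟩

theorem differentiableOn_upperRoot : DifferentiableOn ℂ upperRoot PiPlus := by
  intro z hz
  exact (((differentiableAt_id.neg).cpow_const (c := 1 / 2)
    (neg_mem_slitPlane hz)).const_mul Complex.I).differentiableWithinAt

/-! ### The Weyl function as the quotient `dΔ`/`Δ`. -/

namespace SLProblem

variable {P : SLProblem}

theorem σ_of_lt_a {x : ℝ} (hx : x < P.a) (j : Fin 2) (lam : ℂ) : P.σ j x lam = P.s j x lam := by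
  rw [σ, if_pos hx]

theorem jost_of_lt {x : ℝ} (hx : x < P.a) (ρ : ℂ) : P.jost x ρ =
    P.jostCoeff ρ 0 * P.s 0 x (ρ ^ 2) + P.jostCoeff ρ 1 * P.s 1 x (ρ ^ 2) := by
  rw [jost, Fin.sum_univ_two, σ_of_lt_a hx, σ_of_lt_a hx]

/-- The derivative at the endpoint `0` of the Jost solution. -/
def dΔ (P : SLProblem) (ρ : ℂ) : ℂ :=
  P.jostCoeff ρ 0 * P.ds 0 0 (ρ ^ 2) + P.jostCoeff ρ 1 * P.ds 1 0 (ρ ^ 2)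

theorem Admissible.zero_mem_dom (h : P.Admissible) : (0 : ℝ) ∈ P.dom :=
  ⟨le_rfl, h.a_pos.ne⟩

theorem Admissible.Δ_eq (h : P.Admissible) (ρ : ℂ) : P.Δ ρ =
    P.jostCoeff ρ 0 * P.s 0 0 (ρ ^ 2) + P.jostCoeff ρ 1 * P.s 1 0 (ρ ^ 2) :=
  jost_of_lt h.a_pos ρ

theorem Admissible.hasDerivWithinAt_jost (h : P.Admissible) (ρ : ℂ) :
    HasDerivWithinAt (fun x => P.jost x ρ) (P.dΔ ρ) (Ici 0) 0 := by
  have hdom : Ico 0 P.a ⊆ P.dom := fun x hx => ⟨hx.1, hx.2.ne⟩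
  have h0 : (0 : ℝ) ∈ Ico 0 P.a := ⟨le_rfl, h.a_pos⟩
  have hs := fun k => (h.isSolutionOn_s hdom k (ρ ^ 2)).hasDerivWithinAt h0
  have hd : HasDerivWithinAt (fun x => P.jostCoeff ρ 0 * P.s 0 x (ρ ^ 2) +
      P.jostCoeff ρ 1 * P.s 1 x (ρ ^ 2)) (P.dΔ ρ) (Ico 0 P.a) 0 :=
    ((hs 0).const_mul _).add ((hs 1).const_mul _)
  have hmem : Ico 0 P.a ∈ 𝓝[Ici 0] (0 : ℝ) :=
    mem_of_superset (inter_mem_nhdsWithin (Ici 0) (Iio_mem_nhds h.a_pos)) fun x hx => hx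
  refine (hd.mono_of_mem_nhdsWithin hmem).congr_of_eventuallyEq ?_ (jost_of_lt h.a_pos ρ)
  filter_upwards [mem_nhdsWithin_of_mem_nhds (Iio_mem_nhds h.a_pos)] with x hx
  exact jost_of_lt hx ρ

/-- This also holds where `Δ` vanishes: both sides are then 0 by the convention for division by
zero. -/
theorem Admissible.weylRho_eq (h : P.Admissible) (ρ : ℂ) : P.weylRho ρ = P.dΔ ρ / P.Δ ρ :=
  ((h.hasDerivWithinAt_jost ρ).div_const (P.Δ ρ)).derivWithin
    (uniqueDiffOn_Ici 0 0 self_mem_Ici)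

theorem Admissible.regularity (h : P.Admissible) (hA : P.A.det ≠ 0) :
    (ContinuousOn P.Δ closedUpper ∧ DifferentiableOn ℂ P.Δ openUpper) ∧
      ContinuousOn P.dΔ closedUpper ∧ DifferentiableOn ℂ P.dΔ openUpper := by
  have hs := fun k => (h.differentiable_s k h.zero_mem_dom).comp (differentiable_pow (𝕜 := ℂ) 2)
  have hds := fun k => (h.differentiable_ds k h.zero_mem_dom).comp (differentiable_pow (𝕜 := ℂ) 2)
  refine ⟨continuousOn_and_differentiableOn_of_holCont fun δ hδ => ?_, continuousOn_and_differentiableOn_of_holCont fun δ hδ => ?_⟩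
  · exact (((h.holCont_jostCoeff hA hδ 0).mul (HolCont.of_differentiable (hs 0))).add
      ((h.holCont_jostCoeff hA hδ 1).mul (HolCont.of_differentiable (hs 1)))).congr
      fun ρ _ => h.Δ_eq ρ
  · exact ((h.holCont_jostCoeff hA hδ 0).mul (HolCont.of_differentiable (hds 0))).add
      ((h.holCont_jostCoeff hA hδ 1).mul (HolCont.of_differentiable (hds 1)))

/-- The Jost solution and its derivative do not vanish simultaneously at `0`. -/
theorem Admissible.dΔ_ne_zero (h : P.Admissible) (hA : P.A.det ≠ 0) {ρ : ℂ} (hρ : ρ ∈ closedUpper)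
    (hΔ : P.Δ ρ = 0) : P.dΔ ρ ≠ 0 := by
  intro hd
  rw [h.Δ_eq] at hΔ
  rw [dΔ] at hd
  -- Vanishing of e and e' at 0 is a linear system with determinant 1 for the coefficients, forcing
  -- them to be zero; then e cannot have its limit 1 at infinity.
  have hW := h.wronskian_s (ρ ^ 2) h.zero_mem_dom
  refine (h.isJostCoeff_jostCoeff hA hρ.1 hρ.2).ne_zero ?_
  ext i
  fin_cases i
  · simp only [Fin.zero_eta, Pi.zero_apply]
    linear_combination P.ds 1 0 (ρ ^ 2) * hΔ - P.s 1 0 (ρ ^ 2) * hd - P.jostCoeff ρ 0 * hW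
  · simp only [Fin.mk_one, Pi.zero_apply]
    linear_combination P.s 0 0 (ρ ^ 2) * hd - P.ds 0 0 (ρ ^ 2) * hΔ - P.jostCoeff ρ 1 * hW

/-- The Wronskian at `0` of the Jost solutions on the two banks of the cut. -/
theorem Admissible.wronskian_banks_ne_zero (h : P.Admissible) (hA : P.A.det ≠ 0) {ρ : ℂ}
    (hρ : ρ.im = 0) (hρ0 : ρ ≠ 0) : P.Δ ρ * P.dΔ (-ρ) - P.dΔ ρ * P.Δ (-ρ) ≠ 0 := by
  have h1 := h.isJostCoeff_jostCoeff hA hρ.ge hρ0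
  have h2 := h.isJostCoeff_jostCoeff hA (ρ := -ρ) (by simp [hρ]) (neg_ne_zero.2 hρ0)
  -- The Wronskian at 0 is the determinant of the coefficients times that of s₁, s₂, which is 1;
  -- both banks share the same λ = ρ².
  have hW := h.wronskian_s (ρ ^ 2) h.zero_mem_dom
  refine fun h0 => h1.det_ne_zero hρ0 h2 ?_
  rw [h.Δ_eq, h.Δ_eq, dΔ, dΔ, neg_sq] at h0
  linear_combination h0 - (P.jostCoeff ρ 0 * P.jostCoeff (-ρ) 1 -
    P.jostCoeff ρ 1 * P.jostCoeff (-ρ) 0) * hW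

/-- The points of the upper half-plane where `Δ` does not vanish are dense. -/
theorem Admissible.mem_closure_Δ_ne_zero (h : P.Admissible) (hA : P.A.det ≠ 0) {ρ : ℂ}
    (hρ : ρ ∈ closedUpper) : ρ ∈ closure {z | z ∈ openUpper ∧ P.Δ z ≠ 0} := by
  obtain ⟨⟨hc, hd⟩, -⟩ := h.regularity hA
  by_contra hcl
  obtain ⟨z, hzU, hz⟩ := mem_closure_iff.1 (closedUpper_subset_closure hρ) _
    isClosed_closure.isOpen_compl hcl
  -- If Δ vanished on an open set, the identity theorem would make it vanish on the half-plane and,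
  -- by continuity, on both banks, against the Wronskian at ρ = ±1.
  have hev : P.Δ =ᶠ[𝓝 z] 0 := by
    filter_upwards [isClosed_closure.isOpen_compl.mem_nhds hzU, isOpen_openUpper.mem_nhds hz]
      with w hw hwU
    by_contra hne
    exact hw (subset_closure ⟨hwU, hne⟩)
  have hzero : EqOn P.Δ 0 openUpper := by
    exact (hd.analyticOnNhd isOpen_openUpper).eqOn_zero_of_preconnected_of_eventuallyEq_zero
      isPreconnected_openUpper hz hev
  have hzero' : ∀ w ∈ closedUpper, P.Δ w = 0 := by
    intro w hw
    have : (𝓝[openUpper] w).NeBot :=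
      mem_closure_iff_nhdsWithin_neBot.1 (closedUpper_subset_closure hw)
    refine tendsto_nhds_unique ((hc w hw).mono_left (nhdsWithin_mono w openUpper_subset_closedUpper))
      (tendsto_const_nhds.congr' ?_)
    filter_upwards [self_mem_nhdsWithin] with v hv using (hzero hv).symm
  refine h.wronskian_banks_ne_zero hA (ρ := 1) (by simp) one_ne_zero ?_
  rw [hzero' 1 ⟨by simp, one_ne_zero⟩, hzero' (-1) ⟨by simp, neg_ne_zero.2 one_ne_zero⟩]
  ring

theorem mem_Lam'_iff {z : ℂ} (hz : z ∈ PiPlus) : z ∈ P.Lam' ↔ P.Δ (upperRoot z) = 0 := by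
  constructor
  · rintro ⟨ρ, hρ, hΔ, rfl⟩
    rwa [upperRoot_sq_of_openUpper hρ]
  · intro hΔ
    exact ⟨upperRoot z, upperRoot_im_pos hz, hΔ, (upperRoot_sq z).symm⟩

/-- An analytic continuation `F` of the Weyl function satisfies `F Δ = e'(0)`. -/
theorem Admissible.mul_Δ_eq_dΔ (h : P.Admissible) (hA : P.A.det ≠ 0) {ρ : ℂ}
    (hρ : ρ ∈ closedUpper) {F : ℂ → ℂ} (hF : ContinuousAt F (ρ ^ 2))
    (hFw : ∀ᶠ w in 𝓝[PiPlus \ P.Lam'] (ρ ^ 2), F w = P.weyl w) :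
    F (ρ ^ 2) * P.Δ ρ = P.dΔ ρ := by
  obtain ⟨⟨hc, -⟩, hdc, -⟩ := h.regularity hA
  -- On `G` the relation is the definition of M; it passes to ρ as a limit, both sides being
  -- continuous up to the real axis.
  let G := {z | z ∈ openUpper ∧ P.Δ z ≠ 0}
  have hG : G ⊆ closedUpper := fun z hz => openUpper_subset_closedUpper hz.1
  have : (𝓝[G] ρ).NeBot := mem_closure_iff_nhdsWithin_neBot.1 (h.mem_closure_Δ_ne_zero hA hρ)
  have hsq : Tendsto (fun z : ℂ => z ^ 2) (𝓝[G] ρ) (𝓝 (ρ ^ 2)) :=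
    ((continuous_pow 2).tendsto ρ).mono_left nhdsWithin_le_nhds
  have h1 : Tendsto (fun z => F (z ^ 2) * P.Δ z) (𝓝[G] ρ) (𝓝 (F (ρ ^ 2) * P.Δ ρ)) :=
    (hF.tendsto.comp hsq).mul ((hc ρ hρ).mono_left (nhdsWithin_mono ρ hG))
  have h2 : Tendsto P.dΔ (𝓝[G] ρ) (𝓝 (P.dΔ ρ)) :=
    (hdc ρ hρ).mono_left (nhdsWithin_mono ρ hG)
  refine tendsto_nhds_unique h1 (h2.congr' ?_)
  have hsq' : Tendsto (fun z : ℂ => z ^ 2) (𝓝[G] ρ) (𝓝[PiPlus \ P.Lam'] (ρ ^ 2)) := by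
    refine tendsto_nhdsWithin_iff.2 ⟨hsq, ?_⟩
    filter_upwards [self_mem_nhdsWithin] with z hz
    refine ⟨sq_mem_PiPlus hz.1, fun hL => hz.2 ?_⟩
    rwa [mem_Lam'_iff (sq_mem_PiPlus hz.1), upperRoot_sq_of_openUpper hz.1] at hL
  filter_upwards [hsq'.eventually hFw, self_mem_nhdsWithin] with z hz hzG
  rw [hz, weyl, upperRoot_sq_of_openUpper hzG.1, h.weylRho_eq, div_mul_cancel₀ _ hzG.2]

theorem Admissible.analyticOnNhd_weyl (h : P.Admissible) (hA : P.A.det ≠ 0) :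
    AnalyticOnNhd ℂ P.weyl (PiPlus \ P.Lam') := by
  obtain ⟨⟨-, hd⟩, -, hdd⟩ := h.regularity hA
  have hmaps : MapsTo upperRoot PiPlus openUpper := fun z hz => upperRoot_im_pos hz
  have h1 : DifferentiableOn ℂ (fun z => P.Δ (upperRoot z)) PiPlus :=
    hd.comp differentiableOn_upperRoot hmaps
  have h2 : DifferentiableOn ℂ (fun z => P.dΔ (upperRoot z)) PiPlus :=
    hdd.comp differentiableOn_upperRoot hmaps
  have hset : PiPlus \ P.Lam' = PiPlus ∩ (fun z => P.Δ (upperRoot z)) ⁻¹' {0}ᶜ := by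
    ext z
    constructor
    · rintro ⟨hz, hL⟩
      exact ⟨hz, fun h0 => hL ((mem_Lam'_iff hz).2 h0)⟩
    · rintro ⟨hz, hL⟩
      exact ⟨hz, fun h0 => hL ((mem_Lam'_iff hz).1 h0)⟩
  have hopen : IsOpen (PiPlus \ P.Lam') := by
    rw [hset]
    exact h1.continuousOn.isOpen_inter_preimage isOpen_PiPlus isOpen_compl_singleton
  refine DifferentiableOn.analyticOnNhd ?_ hopen
  refine ((h2.mono sdiff_subset).div (h1.mono sdiff_subset) fun z hz h0 =>
    hz.2 ((mem_Lam'_iff hz.1).2 h0)).congr fun z _ => ?_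
  rw [weyl, h.weylRho_eq]
  rfl

theorem Admissible.continuousOn_weylCut (h : P.Admissible) (hA : P.A.det ≠ 0) :
    ContinuousOn P.weylCut P.LamCutᶜ := by
  obtain ⟨⟨hc, -⟩, hdc, -⟩ := h.regularity hA
  have hmaps : ∀ s : Set CutPlane, MapsTo (fun p : CutPlane => (p : ℂ)) s closedUpper :=
    fun s p _ => p.2
  have h1 := hc.comp continuous_subtype_val.continuousOn (hmaps P.LamCutᶜ)
  have h2 := hdc.comp continuous_subtype_val.continuousOn (hmaps P.LamCutᶜ)
  refine (h2.div h1 fun p hp => hp).congr fun p _ => ?_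
  rw [weylCut, h.weylRho_eq]
  rfl

/-! ### The singularities. -/

theorem Admissible.mem_singularSet_of_mem_Lam' (h : P.Admissible) (hA : P.A.det ≠ 0) {z : ℂ}
    (hz : z ∈ P.Lam') : z ∈ singularSet P.weyl (PiPlus \ P.Lam') := by
  obtain ⟨ρ, hρ, hΔ, rfl⟩ := hz
  rintro ⟨F, hF, hFw⟩
  have hρ' := openUpper_subset_closedUpper (show ρ ∈ openUpper from hρ)
  have h1 := h.mul_Δ_eq_dΔ hA hρ' hF.continuousAt hFw
  rw [hΔ, mul_zero] at h1
  exact h.dΔ_ne_zero hA hρ' hΔ h1.symm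

/-- An analytic F has one value at x, shared by the two banks ±√x; the two relations then make the
Jost solutions on the banks dependent at 0. -/
theorem Admissible.mem_singularSet_of_pos (h : P.Admissible) (hA : P.A.det ≠ 0) {x : ℝ}
    (hx : 0 < x) : ((x : ℝ) : ℂ) ∈ singularSet P.weyl (PiPlus \ P.Lam') := by
  rintro ⟨F, hF, hFw⟩
  let ρ : ℂ := (Real.sqrt x : ℝ)
  have hsq : ρ ^ 2 = x := by
    simp only [ρ]
    exact_mod_cast Real.sq_sqrt hx.le
  have hρ0 : ρ ≠ 0 := by
    simp only [ρ]
    exact_mod_cast (Real.sqrt_pos.2 hx).ne'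
  have him : ρ.im = 0 := Complex.ofReal_im _
  have hnsq : (-ρ) ^ 2 = x := by rw [neg_sq, hsq]
  have h1 := h.mul_Δ_eq_dΔ hA (ρ := ρ) ⟨him.ge, hρ0⟩ (F := F)
    (by rw [hsq]; exact hF.continuousAt) (by rw [hsq]; exact hFw)
  have h2 := h.mul_Δ_eq_dΔ hA (ρ := -ρ) ⟨by simp [him], neg_ne_zero.2 hρ0⟩ (F := F)
    (by rw [hnsq]; exact hF.continuousAt) (by rw [hnsq]; exact hFw)
  rw [hsq] at h1
  rw [hnsq] at h2
  refine h.wronskian_banks_ne_zero hA him hρ0 ?_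
  rw [← h1, ← h2]
  ring

end SLProblem

/-- A continuation F at one point serves at all nearby points. Closedness is what reaches the
origin, as a limit of positive singular points. -/
theorem isClosed_singularSet (f : ℂ → ℂ) (D : Set ℂ) : IsClosed (singularSet f D) := by
  rw [← isOpen_compl_iff, isOpen_iff_mem_nhds]
  intro z hz
  simp only [singularSet, mem_compl_iff, mem_ofPred_eq, not_not] at hz
  obtain ⟨F, hF, hFw⟩ := hz
  have h1 := eventually_eventually_nhds.2 (eventually_nhdsWithin_iff.1 hFw)
  filter_upwards [h1, hF.eventually_analyticAt] with w hw hFa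
  simp only [singularSet, mem_compl_iff, mem_ofPred_eq, not_not]
  exact ⟨F, hFa, eventually_nhdsWithin_iff.2 hw⟩

namespace SLProblem

variable {P : SLProblem}

theorem Admissible.rayPlus_subset_singularSet (h : P.Admissible) (hA : P.A.det ≠ 0) :
    rayPlus ⊆ singularSet P.weyl (PiPlus \ P.Lam') := by
  rintro z ⟨hre, him⟩
  have hz : z = ((z.re : ℝ) : ℂ) := Complex.ext rfl (by simp [him])
  have hlim : Tendsto (fun n : ℕ => ((z.re + 1 / ((n : ℝ) + 1) : ℝ) : ℂ)) atTop (𝓝 z) := by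
    rw [hz]
    have h1 := (tendsto_one_div_add_atTop_nhds_zero_nat (𝕜 := ℝ)).const_add z.re
    rw [add_zero] at h1
    exact (Complex.continuous_ofReal.tendsto z.re).comp h1
  refine (isClosed_singularSet _ _).mem_of_tendsto hlim (Eventually.of_forall fun n => ?_)
  exact h.mem_singularSet_of_pos hA (by positivity)

/-- Real zeros of Δ square into the ray, so only the zeros in the open half-plane need an argument
of their own. -/
theorem Lam_subset : P.Lam ⊆ rayPlus ∪ P.Lam' := by
  rintro z ⟨ρ, hρ, hρ0, hΔ, rfl⟩
  rcases hρ.eq_or_lt with him | hpos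
  · left
    simp only [rayPlus, mem_ofPred_eq, sq, Complex.mul_re, Complex.mul_im, ← him]
    constructor
    · nlinarith [mul_self_nonneg ρ.re]
    · ring
  · exact Or.inr ⟨ρ, hpos, hΔ, rfl⟩

theorem Lam'_subset : P.Lam' ⊆ P.Lam := by
  rintro z ⟨ρ, hρ, hΔ, rfl⟩
  have := openUpper_subset_closedUpper (show ρ ∈ openUpper from hρ)
  exact ⟨ρ, this.1, this.2, hΔ, rfl⟩

end SLProblem

end

theorem theorem1 (P : SLProblem)
    (ha : 0 < P.a)
    (hν : 0 < P.ν.re) (hν' : ∀ n : ℕ, 0 < n → P.ν ≠ (n : ℂ))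
    (hc : P.c₀ 0 * P.c₀ 1 = (2 * P.ν)⁻¹)
    (hq : P.PotentialInW)
    (hA : P.A.det ≠ 0) (hA12 : P.A 0 1 = 0)
    (hξ : ∀ j : Fin 2, ‖P.ξ 0 1‖ < ‖P.ξ j j‖) (hξ12 : 0 < ‖P.ξ 0 1‖) :
    AnalyticOnNhd ℂ P.weyl (PiPlus \ P.Lam') ∧
    ContinuousOn P.weylCut P.LamCutᶜ ∧
    singularSet P.weyl (PiPlus \ P.Lam') = rayPlus ∪ P.Lam := by
  have h : P.Admissible := ⟨ha, hν, hν', hc, hq⟩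
  have han := h.analyticOnNhd_weyl hA
  refine ⟨han, h.continuousOn_weylCut hA, Subset.antisymm (fun z hz => ?_) ?_⟩
  -- Off the ray and Λ the Weyl function is its own analytic continuation.
  · by_contra hn
    rw [mem_union, not_or] at hn
    exact hz ⟨P.weyl, han z ⟨hn.1, fun hL => hn.2 (SLProblem.Lam'_subset hL)⟩,
      Eventually.of_forall fun _ => rfl⟩
  · refine union_subset (h.rayPlus_subset_singularSet hA)
      (SLProblem.Lam_subset.trans (union_subset (h.rayPlus_subset_singularSet hA) ?_))
    exact fun z hz => h.mem_singularSet_of_mem_Lam' hA hz
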